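/- **Setting.** All vector norms $|\cdot|$ are infinity norms, and $\|B\|$ is the infinity norm (largest absolute row sum) of a matrix $B$. Consider a plant $\dot x=f(x,u)$, $x\in\mathbb R^{n}$, $u\in\mathbb R^m$, with $f$ continuous and locally Lipschitz in $x$, and a controller $u=\kappa(\hat x)$, $\kappa$ continuous, which runs the copy $\dot{\hat x}=f(\hat x,\kappa(\hat x))$ between transmission instants $t_0<t_1<\cdots$, $t_k\to\infty$. A box-based dynamic quantizer keeps a box with centre $\hat x$ and half-size $\xi$, where $\dot\xi=g_\xi(\xi)$ between transmissions, $g_\xi$ continuous. With $e=x-\hat x$, $\bar e=(e,\xi)\in\mathbb R^{n+1}$, the flow on $(t_k,t_{k+1})$ is $$\dot x=\tilde f(x,e)=f(x,\kappa(x-e)),\quad \dot e=g_e(x,e)=f(x,\kappa(x-e))-f(x-e,\kappa(x-e)),\quad \dot\xi=g_\xi(\xi),$$ and $\bar g(x,\bar e)=(g_e(x,e),g_\xi(\xi))$. At $t_k$, with $R_k\in\mathbb N$ bits available, $x$ is continuous and $\bar e(t_k^+)=\bar J(k,x(t_k),\bar e(t_k),R_k)$, where $\bar J(k,x,e,\xi,r)=\big(x-h,\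 \xi/2^{r}\big)$ and $h=h(k,q,\hat x,\xi,r)$ is computed from $k$, $\hat x=x-e$, $\xi$, $r$ and a symbol $q$ from a finite set (which may depend on $r$); $q$ names the sub-box of half-size $\xi/2^{r}$ that contains $x$ and $h$ is its centre, so that $|x-h|\le \xi/2^{r}$ whenever $|x-\hat x|\le\xi$. The box is propagated so that it captures the state: every flow that starts with $|e|\le\xi$ keeps $|e|\le\xi$. Initially $|e(t_0)|\le\xi(t_0)$. The rates $R_k$ take values in $\{r_1<\dots<r_{M}\}\subset\mathbb N$. The environment $s_k$ is a finite Markov decision process with fixed initial state and transition law $q(s\,|\,s',a)$, and $p_k$ is the transmission power, from a finite set. The channel is a state-dependent Markov channel: given $s_k=s$, $p_k=p$, $R_k=r_j$ and any earlier rates, $R_{k+1}=r_i$ with probability $P_{ij}(s,p)$. Under the given joint policy $\mu$, for $k\ge1$ and given $R_k=r_j$ and any earlier rates, the pair $(s_k,p_k)$ has the law $\mathbb P(s,p\,|\,r_j)$. Put $\overline P_{ij}(\mu)=\sum_{s,p}P_{ij}(s,p)\,\mathbb P(s,p\,|\,r_j)$. **Theorem.** Suppose that there are locally Lipschitz functions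 $W(k,\cdot):\mathbb R^{n+1}\to\mathbb R_{\ge0}$ ($k\in\mathbb N$) and $V:\mathbb R^{n}\to\mathbb R_{\ge0}$, a continuous $H:\mathbb R^n\to\mathbb R_{\ge0}$, and constants $\lambda_1,\dots,\lambda_{M}$, $L\ge0$, $\zeta>0$, $\underline\alpha_W,\overline\alpha_W,\underline\alpha_V,\overline\alpha_V,\varrho>0$ such that for all $k\in\mathbb N$: 1. $\underline\alpha_W|\bar e|\le W(k,\bar e)\le\overline\alpha_W|\bar e|$ for all $\bar e$, and $W(k+1,\bar J(k,x,\bar e,r_i))\le\lambda_iW(k,\bar e)$ for all $i$, $x$ and all $\bar e=(e,\xi)$ with $|e|\le\xi$; 2. for all $x$ and almost all $\bar e\in\mathbb R^{n+1}$, $\langle\partial W(k,\bar e)/\partial\bar e,\ \bar g(x,\bar e)\rangle\le LW(k,\bar e)+H(x)$; 3. $\underline\alpha_V|x|^2\le V(x)\le\overline\alpha_V|x|^2$ for all $x$, and for all $\bar e=(e,\xi)\in\mathbb R^{n+1}$ and almost all $x$, $$\langle\nabla V(x),\tilde f(x,e)\rangle\le-\varrho|x|^2-\varrho W^2(k,\bar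 e)-H^2(x)+\zeta^2W^2(k,\bar e).$$ Let $\overline\lambda>\sqrt{\|\operatorname{diag}(\lambda_i^2)\,\overline P(\mu)\|}$, and let $t_{k+1}-t_k\le T_{MATI}$ for all $k$, where, with $\eta=\sqrt{|(\zeta/L)^2-1|}$, $$T_{MATI}\le\begin{cases}\dfrac1{L\eta}\arctan\left(\dfrac{\eta(1-\overline\lambda)}{2\frac{\overline\lambda}{1+\overline\lambda}(\frac\zeta L-1)+1+\overline\lambda}\right)&\zeta>L,\\[2ex]\dfrac1L\,\dfrac{1-\overline\lambda}{1+\overline\lambda}&\zeta=L,\\[2ex]\dfrac1{L\eta}\operatorname{arctanh}\left(\dfrac{\eta(1-\overline\lambda)}{2\frac{\overline\lambda}{1+\overline\lambda}(\frac\zeta L-1)+1+\overline\lambda}\right)&\zeta<L\end{cases}$$ (for $L=0$ the right-hand side is its limit as $L\downarrow0$). Then the system is almost surely asymptotically stable: along its trajectories, for every $\epsilon>0$, $$\mathbb P\Big\{\lim_{t'\to\infty}\ \sup_{t\ge t'}|x(t)|\ge\epsilon\Big\}=0 .$$ -/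

import Mathlib

open Set Filter Topology MeasureTheory

noncomputable section

/-- `ℝⁿ` with the infinity norm (the norm that Mathlib puts on `Fin n → ℝ`). The augmented error
`[e; ξ]` lives in `Vec n × ℝ`, whose product norm is again the infinity norm. -/
abbrev Vec (n : ℕ) : Type := Fin n → ℝ

/-- A box-based dynamic quantizer. The box has centre `c` and half-size `ξ`. With `r` bits it is
divided into finitely many sub-boxes of half-size `ξ / 2 ^ r`; `encode r c ξ x` is the symbol of the
sub-box that contains `x`, and `decode k r σ c ξ` is the centre of the sub-box with symbol `σ`, used
as the new estimate at the `k`-th transmission. -/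
structure BoxQuantizer (n : ℕ) where
  Symbol : ℕ → Type
  finite_symbol : ∀ r, Finite (Symbol r)
  encode : (r : ℕ) → Vec n → ℝ → Vec n → Symbol r
  decode : (k : ℕ) → (r : ℕ) → Symbol r → Vec n → ℝ → Vec n
  mem_subbox : ∀ (k r : ℕ) (c : Vec n) (ξ : ℝ) (x : Vec n), ‖x - c‖ ≤ ξ →
    ‖x - decode k r (encode r c ξ x) c ξ‖ ≤ ξ / 2 ^ r

/-- The data of the networked control system: plant `ẋ = f (x, u)`, nominal controller `u = κ x̂`,
growth `ξ̇ = gξ ξ` of the box size between transmissions, and the quantizer. -/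
structure NCS (n m : ℕ) where
  f : Vec n → Vec m → Vec n
  κ : Vec n → Vec m
  gξ : ℝ → ℝ
  quantizer : BoxQuantizer n
  locallyLipschitz_f : ∀ u, LocallyLipschitz fun x => f x u
  continuous_f : Continuous fun z : Vec n × Vec m => f z.1 z.2
  continuous_κ : Continuous κ
  continuous_gξ : Continuous gξ

namespace NCS

variable {n m : ℕ} (N : NCS n m)

/-- Flow of the plant state in terms of `x` and the estimation error `e = x - x̂`. -/
def fTilde (x e : Vec n) : Vec n := N.f x (N.κ (x - e))

/-- Flow of the estimation error: the controller runs the copy `d/dt x̂ = f (x̂, κ x̂)`. -/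
def gE (x e : Vec n) : Vec n := N.f x (N.κ (x - e)) - N.f (x - e) (N.κ (x - e))

/-- Flow of the augmented error `[e; ξ]`. -/
def gBar (x : Vec n) (eb : Vec n × ℝ) : Vec n × ℝ := (N.gE x eb.1, N.gξ eb.2)

/-- Jump of the estimation error at the `k`-th transmission, with `r` bits. -/
def jumpE (k : ℕ) (x e : Vec n) (ξ : ℝ) (r : ℕ) : Vec n :=
  x - N.quantizer.decode k r (N.quantizer.encode r (x - e) ξ x) (x - e) ξ

/-- Jump of the box size. -/
def jumpXi (ξ : ℝ) (r : ℕ) : ℝ := ξ / 2 ^ r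

/-- Jump of the augmented error `[e; ξ]`. -/
def jumpBar (k : ℕ) (x : Vec n) (eb : Vec n × ℝ) (r : ℕ) : Vec n × ℝ :=
  (N.jumpE k x eb.1 eb.2 r, jumpXi eb.2 r)

/-- `x, e, ξ` solve the continuous dynamics on the open interval `(a, b)`. -/
def FlowsOn (a b : ℝ) (x e : ℝ → Vec n) (ξ : ℝ → ℝ) : Prop :=
  ∀ τ ∈ Ioo a b, HasDerivAt x (N.fTilde (x τ) (e τ)) τ ∧
    HasDerivAt e (N.gE (x τ) (e τ)) τ ∧ HasDerivAt ξ (N.gξ (ξ τ)) τ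

/-- The box size is propagated so that the box captures the plant state: along every flow of the
continuous dynamics that starts with the state in the box, the state stays in the box. -/
def BoxCapturesState : Prop :=
  ∀ (a b : ℝ) (x e : ℝ → Vec n) (ξ : ℝ → ℝ), a < b →
    ContinuousOn x (Icc a b) → ContinuousOn e (Icc a b) → ContinuousOn ξ (Icc a b) →
    N.FlowsOn a b x e ξ → ‖e a‖ ≤ ξ a → ∀ τ ∈ Icc a b, ‖e τ‖ ≤ ξ τ

/-- A trajectory of the hybrid system for transmission instants `t k` and numbers of bits `r k`,
started with the plant state in the initial box. The values `e (t k)`, `ξ (t k)` are those just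
before the `k`-th transmission; those just after it are the right limits. -/
structure IsTrajectory (t : ℕ → ℝ) (r : ℕ → ℕ) (x e : ℝ → Vec n) (ξ : ℝ → ℝ) : Prop where
  initial : ‖e (t 0)‖ ≤ ξ (t 0)
  continuousOn_x : ContinuousOn x (Ici (t 0))
  flow : ∀ k, N.FlowsOn (t k) (t (k + 1)) x e ξ
  left_e : ∀ k, Tendsto e (𝓝[<] t (k + 1)) (𝓝 (e (t (k + 1))))
  left_ξ : ∀ k, Tendsto ξ (𝓝[<] t (k + 1)) (𝓝 (ξ (t (k + 1))))
  jump_e : ∀ k, Tendsto e (𝓝[>] t k) (𝓝 (N.jumpE k (x (t k)) (e (t k)) (ξ (t k)) (r k)))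
  jump_ξ : ∀ k, Tendsto ξ (𝓝[>] t k) (𝓝 (jumpXi (ξ (t k)) (r k)))

/-- The Lyapunov-type conditions with linear bounds on `W`, quadratic bounds on `V` and quadratic
decay. The jump condition concerns the states for which the quantizer is designed, namely those in
which the box captures the plant state. Locally Lipschitz functions are differentiable almost
everywhere, so the gradient conditions do constrain `W` and `V` almost everywhere. -/
structure QuadraticConditions {M : ℕ} (rate : Fin M → ℕ) (W : ℕ → Vec n × ℝ → ℝ)
    (V H : Vec n → ℝ) (lam : Fin M → ℝ) (L ζ αW βW αV βV ϱ : ℝ) : Prop where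
  L_nonneg : 0 ≤ L
  ζ_pos : 0 < ζ
  αW_pos : 0 < αW
  βW_pos : 0 < βW
  αV_pos : 0 < αV
  βV_pos : 0 < βV
  ϱ_pos : 0 < ϱ
  W_lipschitz : ∀ k, LocallyLipschitz (W k)
  V_lipschitz : LocallyLipschitz V
  H_continuous : Continuous H
  H_nonneg : ∀ x, 0 ≤ H x
  W_bounds : ∀ k eb, αW * ‖eb‖ ≤ W k eb ∧ W k eb ≤ βW * ‖eb‖
  W_jump : ∀ (k : ℕ) (x : Vec n) (eb : Vec n × ℝ) (i : Fin M), ‖eb.1‖ ≤ eb.2 →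
    W (k + 1) (N.jumpBar k x eb (rate i)) ≤ lam i * W k eb
  W_flow : ∀ (k : ℕ) (x : Vec n), ∀ᵐ eb : Vec n × ℝ, DifferentiableAt ℝ (W k) eb →
    fderiv ℝ (W k) eb (N.gBar x eb) ≤ L * W k eb + H x
  V_bounds : ∀ x, αV * ‖x‖ ^ 2 ≤ V x ∧ V x ≤ βV * ‖x‖ ^ 2
  V_flow : ∀ (k : ℕ) (eb : Vec n × ℝ), ∀ᵐ x : Vec n, DifferentiableAt ℝ V x →
    fderiv ℝ V x (N.fTilde x eb.1) ≤
      -ϱ * ‖x‖ ^ 2 - ϱ * W k eb ^ 2 - H x ^ 2 + ζ ^ 2 * W k eb ^ 2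

end NCS

/-- A finite Markov decision process with initial state `init` and transition law
`trans s' a` of the next state when action `a` is taken in state `s'`. -/
structure MDP (S A : Type*) where
  init : S
  trans : S → A → PMF S

section Network

variable {Ω S A Pw : Type*} [MeasurableSpace Ω] {M : ℕ}

/-- Random variable with values in a finite set. -/
def IsDiscreteRV {α : Type*} (X : Ω → α) : Prop := ∀ a, MeasurableSet (X ⁻¹' {a})

/-- The environment states `s k` and actions `a k` evolve according to the Markov decision process;
the actions may be chosen by any control policy. -/
def MDP.Governs (E : MDP S A) (Pr : Measure Ω) (s : ℕ → Ω → S) (a : ℕ → Ω → A) : Prop :=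
  (∀ᵐ ω ∂Pr, s 0 ω = E.init) ∧
  ∀ (k : ℕ) (σ : ℕ → S) (α : ℕ → A) (s' : S),
    Pr {ω | (∀ l ≤ k, s l ω = σ l ∧ a l ω = α l) ∧ s (k + 1) ω = s'} =
      E.trans (σ k) (α k) s' * Pr {ω | ∀ l ≤ k, s l ω = σ l ∧ a l ω = α l}

/-- State-dependent Markov channel: `chan s p j i` is the probability `P_ij(s, p)` that the data
rate moves from the `j`-th to the `i`-th one in environment state `s` with transmission power `p`,
whatever the earlier rates were. `R k` is the index of the rate at the `k`-th transmission. -/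
def IsSDMC (chan : S → Pw → Fin M → PMF (Fin M)) (Pr : Measure Ω)
    (s : ℕ → Ω → S) (p : ℕ → Ω → Pw) (R : ℕ → Ω → Fin M) : Prop :=
  ∀ (k : ℕ) (ρ : ℕ → Fin M) (σ : S) (π : Pw) (i : Fin M),
    Pr {ω | (∀ l ≤ k, R l ω = ρ l) ∧ s k ω = σ ∧ p k ω = π ∧ R (k + 1) ω = i} =
      chan σ π (ρ k) i * Pr {ω | (∀ l ≤ k, R l ω = ρ l) ∧ s k ω = σ ∧ p k ω = π}

/-- `μ j` is the law `ℙ(s, p | r_j)` of environment state and transmission power that the joint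
policy induces when the current rate is `r_j`, whatever the earlier rates were. The initial
environment state is prescribed by the decision process, so this starts at `k = 1`. -/
def InducesJointLaw (μ : Fin M → PMF (S × Pw)) (Pr : Measure Ω)
    (s : ℕ → Ω → S) (p : ℕ → Ω → Pw) (R : ℕ → Ω → Fin M) : Prop :=
  ∀ (k : ℕ), 1 ≤ k → ∀ (ρ : ℕ → Fin M) (σ : S) (π : Pw),
    Pr {ω | (∀ l ≤ k, R l ω = ρ l) ∧ s k ω = σ ∧ p k ω = π} =
      μ (ρ k) (σ, π) * Pr {ω | ∀ l ≤ k, R l ω = ρ l}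

/-- The matrix `P̄(μ)`, with entry `P̄_ij = ∑_{s, p} P_ij(s, p) ℙ(s, p | r_j)`. -/
def rateMatrix [Fintype S] [Fintype Pw] (chan : S → Pw → Fin M → PMF (Fin M))
    (μ : Fin M → PMF (S × Pw)) : Matrix (Fin M) (Fin M) ℝ :=
  Matrix.of fun i j => ∑ s, ∑ p, (chan s p j i).toReal * (μ j (s, p)).toReal

/-- Almost sure asymptotic stability:
`ℙ (lim_{t' → ∞} sup_{t ≥ t'} |x(t)| ≥ ε) = 0` for all `ε > 0`. The supremum decreases with `t'`, so
its limit is an infimum; it is taken in `[0, ∞]`. -/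
def IsASAS {n : ℕ} (Pr : Measure Ω) (x : Ω → ℝ → Vec n) : Prop :=
  ∀ ε : ℝ, 0 < ε → Pr {ω | ENNReal.ofReal ε ≤ ⨅ t' : ℝ, ⨆ t ≥ t', ‖x ω t‖ₑ} = 0

end Network

/-- The infinity norm of a square matrix: the largest absolute row sum. -/
def inftyNorm {M : ℕ} (B : Matrix (Fin M) (Fin M) ℝ) : ℝ :=
  (Matrix.linftyOpNormedAddCommGroup (m := Fin M) (n := Fin M) (α := ℝ)).toNorm.norm B

/-- The bound on the maximum allowable transmission interval. It is written without division by
`L`, with `√|ζ² - L²| = L η`, so that it also makes sense for `L = 0`. -/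
def matiBound (L ζ lamBar : ℝ) : ℝ :=
  if L < ζ then
    1 / √|ζ ^ 2 - L ^ 2| * Real.arctan (√|ζ ^ 2 - L ^ 2| * (1 - lamBar) /
      (2 * (lamBar / (1 + lamBar)) * (ζ - L) + L * (1 + lamBar)))
  else if ζ = L then 1 / L * ((1 - lamBar) / (1 + lamBar))
  else
    1 / √|ζ ^ 2 - L ^ 2| * Real.artanh (√|ζ ^ 2 - L ^ 2| * (1 - lamBar) /
      (2 * (lamBar / (1 + lamBar)) * (ζ - L) + L * (1 + lamBar)))

/-- For `L > 0` the bound is the usual one, with `η = √|(ζ / L)² - 1|`. -/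
theorem matiBound_eq {L ζ lamBar : ℝ} (hL : 0 < L) :
    matiBound L ζ lamBar =
      if L < ζ then
        1 / (L * √|(ζ / L) ^ 2 - 1|) * Real.arctan (√|(ζ / L) ^ 2 - 1| * (1 - lamBar) /
          (2 * (lamBar / (1 + lamBar)) * (ζ / L - 1) + 1 + lamBar))
      else if ζ = L then 1 / L * ((1 - lamBar) / (1 + lamBar))
      else
        1 / (L * √|(ζ / L) ^ 2 - 1|) * Real.artanh (√|(ζ / L) ^ 2 - 1| * (1 - lamBar) /
          (2 * (lamBar / (1 + lamBar)) * (ζ / L - 1) + 1 + lamBar)) := by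
  have h1 : √|ζ ^ 2 - L ^ 2| = L * √|(ζ / L) ^ 2 - 1| := by
    have : |ζ ^ 2 - L ^ 2| = L ^ 2 * |(ζ / L) ^ 2 - 1| := by
      rw [← abs_of_nonneg (sq_nonneg L), ← abs_mul, abs_of_nonneg (sq_nonneg L)]
      congr 1
      field_simp
    rw [this, Real.sqrt_mul (sq_nonneg L), Real.sqrt_sq hL.le]
  have h2 : 2 * (lamBar / (1 + lamBar)) * (ζ - L) + L * (1 + lamBar) =
      L * (2 * (lamBar / (1 + lamBar)) * (ζ / L - 1) + 1 + lamBar) := by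
    have : ζ = L * (ζ / L) := by field_simp
    rw [show ζ - L = L * (ζ / L - 1) by rw [mul_sub, ← this, mul_one]]
    ring
  unfold matiBound
  rw [h1, h2, mul_assoc L, mul_div_mul_left _ _ hL.ne']

end

/-! The box size receives no feedback from the plant, so its evolution may be compared with a
fictitious flow started at plant state zero with any error in the box. There `H` vanishes
(`H_zero`), since `V` is minimal at zero, and the flow condition on `W` becomes growth at rate at
most `L`. Minimising `W` over the errors in the box gives `boxMin`, a function of the box size alone
that dominates `αW * ξ`, grows at rate at most `L` between transmissions
(`eventually_slope_boxMin_lt`) and gains at most the factor `lam i` at a jump (`boxMin_jump`).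

The bound on the transmission intervals enters through `Real.exp (L * T) * lamBar ≤ 1`
(`exp_mul_le_one_of_le_matiBound`). Together with the condition on `lamBar`, it makes the row sums
of the matrix of squared cycle gains, weighted with the rate probabilities, smaller than one.
Expected products of gains then decay geometrically and are summable, so the products vanish almost
surely (`ae_tendsto_gainProd`) and `ξ` tends to zero (`tendsto_ξ`). Since the box captures the
state, the error vanishes too, and `V` satisfies a linear decay inequality with vanishing forcing,
whence `x` tends to zero (`tendsto_x`).

Two analytic tools support this. The gradient bounds hold only almost everywhere, while a trajectory
may stay in the exceptional null set; averaging over translates turns them into Dini derivative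
bounds at every point (`LocallyLipschitz.eventually_slope_lt`). The closed-loop field is merely
continuous, so the fictitious flow comes from Peano's theorem. -/

/-! ### Solvability of continuous differential equations -/

open ODE Metric Function in
/-- A continuous vector field can be solved approximately, with Lipschitz constant and time of
existence independent of the accuracy. -/
theorem exists_approx_integralCurve {E : Type*} [NormedAddCommGroup E] [NormedSpace ℝ E]
    [FiniteDimensional ℝ E] {v : E → E} (hv : Continuous v) (z₀ : E) {B : NNReal}
    (hB : ∀ z ∈ closedBall z₀ 1, ‖v z‖ + 1 ≤ B) {δ : ℝ} (hδ : 0 ≤ δ) (hBδ : B * δ ≤ 1)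
    {ε : ℝ} (hε : 0 < ε) (hε1 : ε ≤ 1) :
    ∃ c : Icc (0 : ℝ) δ → E, LipschitzWith B c ∧ (∀ t, c t ∈ closedBall z₀ 1) ∧
      ∀ t : Icc (0 : ℝ) δ,
        ‖c t - (z₀ + ∫ s in (0 : ℝ)..t, v (c (projIcc 0 δ hδ s)))‖ ≤ ε * δ := by
  -- Picard–Lindelöf applies to a C¹ field within `ε` of `v`. As `ε ≤ 1`, its speed on the ball is
  -- at most `B`, so the existence time does not depend on `ε`; only the local Lipschitz constant
  -- `K` does.
  obtain ⟨g, hg, hgv, -⟩ := hv.exists_contDiff_approx (ε := fun _ => ε) 1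
    continuous_const fun _ => hε
  obtain ⟨K, hK⟩ := (hg.locallyLipschitz.locallyLipschitzOn
    (s := closedBall z₀ 1)).exists_lipschitzOnWith_of_compact (isCompact_closedBall z₀ 1)
  have hgv' : ∀ z, ‖g z - v z‖ ≤ ε := fun z => by
    rw [← dist_eq_norm]; exact (hgv z).le
  have hpl : IsPicardLindelof (fun _ => g) (⟨0, le_rfl, hδ⟩ : Icc (0 : ℝ) δ) z₀ 1 0 B K := by
    refine .of_time_independent (fun z hz => ?_) hK ?_
    · have := norm_sub_norm_le (g z) (v z)
      have := hgv' z
      have := hB z hz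
      linarith
    · simpa [max_eq_left hδ] using hBδ
  have hx : z₀ ∈ closedBall z₀ ((0 : NNReal) : ℝ) := by simp
  obtain ⟨α, hα⟩ := FunSpace.exists_isFixedPt_next hpl hx
  have hmem : ∀ t, α t ∈ closedBall z₀ 1 := fun t => by
    simpa using α.mem_closedBall hpl.mul_max_le (t := t)
  refine ⟨α, α.lipschitzWith, hmem, fun t => ?_⟩
  have h1 : α t = z₀ + ∫ s in (0 : ℝ)..t, g (α (projIcc 0 δ hδ s)) := by
    conv_lhs => rw [← hα.eq]
    rw [FunSpace.next_apply]
    rfl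
  have hcont : Continuous fun s => α (projIcc 0 δ hδ s) :=
    α.lipschitzWith.continuous.comp continuous_projIcc
  have hgc : Continuous fun s => g (α (projIcc 0 δ hδ s)) := hg.continuous.comp hcont
  have hvc : Continuous fun s => v (α (projIcc 0 δ hδ s)) := hv.comp hcont
  rw [h1, add_sub_add_left_eq_sub, ← intervalIntegral.integral_sub
    (hgc.intervalIntegrable _ _) (hvc.intervalIntegrable _ _)]
  refine (intervalIntegral.norm_integral_le_of_norm_le_const (C := ε)
    fun s _ => hgv' _).trans ?_
  rw [sub_zero, abs_of_nonneg t.2.1]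
  exact mul_le_mul_of_nonneg_left t.2.2 hε.le

open Metric BoundedContinuousFunction in
/-- **Peano's existence theorem** for autonomous vector fields. -/
theorem exists_hasDerivAt_of_continuous {E : Type*} [NormedAddCommGroup E] [NormedSpace ℝ E]
    [FiniteDimensional ℝ E] {v : E → E} (hv : Continuous v) (z₀ : E) :
    ∃ δ > 0, ∃ c : ℝ → E, c 0 = z₀ ∧ ∀ t ∈ Icc 0 δ, HasDerivAt c (v (c t)) t := by
  obtain ⟨b, hb⟩ := (isCompact_closedBall z₀ 1).exists_bound_of_continuousOn hv.continuousOn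
  have hb0 : 0 ≤ b := (norm_nonneg _).trans (hb z₀ (by simp))
  set B : NNReal := ⟨b + 1, by linarith⟩ with hBdef
  have hBpos : (0 : ℝ) < B := by change 0 < b + 1; linarith
  have hB : ∀ z ∈ closedBall z₀ 1, ‖v z‖ + 1 ≤ B := fun z hz => by
    change _ ≤ b + 1
    linarith [hb z hz]
  set δ : ℝ := 1 / B with hδdef
  have hδ : 0 < δ := by positivity
  have hBδ : B * δ ≤ 1 := by rw [hδdef, mul_one_div_cancel hBpos.ne']
  choose c hcL hcB hc using fun k : ℕ => exists_approx_integralCurve hv z₀ hB hδ.le hBδ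
    (ε := 1 / ((k : ℝ) + 1)) (by positivity)
    (by rw [div_le_one (by positivity)]; linarith [(Nat.cast_nonneg k : (0 : ℝ) ≤ k)])
  -- The common Lipschitz constant gives equicontinuity; by Arzelà–Ascoli a subsequence converges
  -- uniformly, and the integral equation passes to the limit.
  let F : ℕ → (Icc (0 : ℝ) δ →ᵇ E) := fun k => mkOfCompact ⟨c k, (hcL k).continuous⟩
  have hcomp : IsCompact (closure (range F)) := by
    refine arzela_ascoli (closedBall z₀ 1) (isCompact_closedBall z₀ 1) _ ?_ ?_
    · rintro _ t ⟨k, rfl⟩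
      exact hcB k t
    · refine (LipschitzWith.uniformEquicontinuous _ B ?_).equicontinuous
      rintro ⟨_, k, rfl⟩
      exact hcL k
  obtain ⟨G, -, φ, hφ, hG⟩ := hcomp.tendsto_subseq fun k => subset_closure (mem_range_self k)
  have hGt : ∀ t, Tendsto (fun k => c (φ k) t) atTop (𝓝 (G t)) := fun t =>
    ((continuous_eval_const (F := Icc (0 : ℝ) δ →ᵇ E) t).tendsto G).comp hG
  have hGcont : Continuous fun s => v (G (projIcc 0 δ hδ.le s)) :=
    hv.comp (G.continuous.comp continuous_projIcc)
  have hint : ∀ t : Icc (0 : ℝ) δ,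
      G t = z₀ + ∫ s in (0 : ℝ)..t, v (G (projIcc 0 δ hδ.le s)) := by
    intro t
    have hI : Tendsto (fun k => ∫ s in (0 : ℝ)..t, v (c (φ k) (projIcc 0 δ hδ.le s))) atTop
        (𝓝 (∫ s in (0 : ℝ)..t, v (G (projIcc 0 δ hδ.le s)))) := by
      refine intervalIntegral.tendsto_integral_filter_of_dominated_convergence (fun _ => (B : ℝ))
        (.of_forall fun k => ?_) (.of_forall fun k => ?_) intervalIntegrable_const ?_
      · exact (hv.comp ((hcL (φ k)).continuous.comp continuous_projIcc)).aestronglyMeasurable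
      · exact .of_forall fun s _ => by linarith [hB _ (hcB (φ k) (projIcc 0 δ hδ.le s))]
      · exact .of_forall fun s _ => (hv.tendsto _).comp (hGt _)
    have hlim := ((hGt t).sub (hI.const_add z₀)).norm
    have hzero : Tendsto (fun k : ℕ => 1 / ((φ k : ℝ) + 1) * δ) atTop (𝓝 0) := by
      simpa using (tendsto_one_div_add_atTop_nhds_zero_nat.comp hφ.tendsto_atTop).mul_const δ
    have := le_of_tendsto_of_tendsto' hlim hzero fun k => hc (φ k) t
    exact sub_eq_zero.1 (norm_le_zero_iff.1 this)
  -- The integrand is frozen outside the interval by `projIcc`, hence continuous on the whole line;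
  -- this yields two-sided derivatives at the endpoints as well.
  refine ⟨δ, hδ, fun t => z₀ + ∫ s in (0 : ℝ)..t, v (G (projIcc 0 δ hδ.le s)), by simp,
    fun t ht => ?_⟩
  have hd := (intervalIntegral.integral_hasDerivAt_right (hGcont.intervalIntegrable 0 t)
    (hGcont.stronglyMeasurableAtFilter _ _) hGcont.continuousAt).const_add z₀
  have h1 := hint ⟨t, ht⟩
  simp only at h1 ⊢
  rw [← h1]
  rwa [projIcc_of_mem hδ.le ht] at hd

/-! ### Locally Lipschitz functions with almost everywhere gradient bounds -/

section DirectionalDerivative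

variable {E : Type*} [NormedAddCommGroup E] [NormedSpace ℝ E] [FiniteDimensional ℝ E]
  [MeasurableSpace E] [BorelSpace E]

open Metric in
/-- If the derivative of a Lipschitz function in direction `w` is at most `r` almost everywhere in a
ball, then its increments in direction `w` from the centre are bounded accordingly. -/
theorem LipschitzWith.sub_le_of_ae_fderiv_le (μ : Measure E) [μ.IsAddHaarMeasure] {F : E → ℝ}
    {K : NNReal} (hF : LipschitzWith K F) {z₀ w : E} {r ρ : ℝ}
    (hae : ∀ᵐ z ∂μ, z ∈ ball z₀ ρ → fderiv ℝ F z w ≤ r) {h : ℝ} (hh : 0 ≤ h)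
    (hρ : h * ‖w‖ < ρ) : F (z₀ + h • w) - F z₀ ≤ r * h := by
  -- An excessive increment at the centre persists, by continuity, on a small ball of starting
  -- points. Averaging over that ball makes the increment differentiable in the step length and the
  -- null set harmless.
  by_contra! hlt
  obtain ⟨a, hra, haF⟩ := exists_between hlt
  have hcont : Continuous fun y => F (y + h • w) - F y :=
    (hF.continuous.comp (continuous_id.add continuous_const)).sub hF.continuous
  obtain ⟨s, hs, hsa⟩ := Metric.mem_nhds_iff.1
    (hcont.continuousAt.preimage_mem_nhds (Ioi_mem_nhds haF))
  -- The second bound keeps all translates by at most `h • w` inside the ball of radius `ρ`.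
  set s' := min s (ρ - h * ‖w‖) with hs'
  have hs'0 : 0 < s' := lt_min hs (by linarith)
  set ν := μ.restrict (ball z₀ s') with hν
  have hfin : IsFiniteMeasure ν := ⟨by
    rw [hν, Measure.restrict_apply_univ]; exact measure_ball_lt_top⟩
  have hint : ∀ τ : ℝ, Integrable (fun y => F (y + τ • w)) ν := fun τ =>
    ((hF.continuous.comp (continuous_id.add continuous_const)).continuousOn.integrableOn_compact
      (isCompact_closedBall z₀ s')).mono_set ball_subset_closedBall
  have hderiv : ∀ τ : ℝ, Integrable (fun y => fderiv ℝ F (y + τ • w) w) ν ∧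
      HasDerivAt (fun τ : ℝ => ∫ y, F (y + τ • w) ∂ν) (∫ y, fderiv ℝ F (y + τ • w) w ∂ν) τ := by
    intro τ
    refine hasDerivAt_integral_of_dominated_loc_of_lip (bound := fun _ => K * ‖w‖) (s := univ)
      univ_mem (.of_forall fun σ => (hint σ).aestronglyMeasurable) (hint τ) ?_
      (.of_forall fun y => ?_) (integrable_const _) ?_
    · exact ((measurable_fderiv_apply_const ℝ F w).comp
        (measurable_add_const (τ • w))).aestronglyMeasurable
    · refine LipschitzWith.lipschitzOnWith (.of_dist_le_mul fun σ σ' => ?_)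
      refine (hF.dist_le_mul _ _).trans ?_
      rw [dist_add_left, dist_eq_norm, ← sub_smul, norm_smul, ← dist_eq_norm,
        Real.coe_nnabs, abs_of_nonneg (by positivity)]
      exact le_of_eq (by ring)
    · refine ae_restrict_of_ae ?_
      filter_upwards [(measurePreserving_add_right μ (τ • w)).quasiMeasurePreserving.ae
        (hF.ae_differentiableAt (μ := μ))] with y hy
      have h1 : HasDerivAt (fun τ : ℝ => y + τ • w) w τ := by
        simpa using ((hasDerivAt_id τ).smul_const w).const_add y
      exact hy.hasFDerivAt.comp_hasDerivAt τ h1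
  have hle : ∀ τ ∈ Icc 0 h, ∫ y, fderiv ℝ F (y + τ • w) w ∂ν ≤ r * ν.real univ := by
    intro τ hτ
    have : ∫ y, fderiv ℝ F (y + τ • w) w ∂ν ≤ ∫ _, r ∂ν := by
      refine integral_mono_ae (hderiv τ).1 (integrable_const _) ?_
      rw [hν]
      filter_upwards [ae_restrict_of_ae ((measurePreserving_add_right μ
        (τ • w)).quasiMeasurePreserving.ae hae), ae_restrict_mem measurableSet_ball] with y hy hyb
      refine hy ?_
      rw [mem_ball, dist_eq_norm] at hyb ⊢
      calc ‖y + τ • w - z₀‖ = ‖(y - z₀) + τ • w‖ := by congr 1; abel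
        _ ≤ ‖y - z₀‖ + ‖τ • w‖ := norm_add_le _ _
        _ < s' + h * ‖w‖ := by
          rw [norm_smul, Real.norm_of_nonneg hτ.1]
          exact add_lt_add_of_lt_of_le hyb (mul_le_mul_of_nonneg_right hτ.2 (norm_nonneg _))
        _ ≤ ρ := by linarith [min_le_right s (ρ - h * ‖w‖)]
    simpa [integral_const, mul_comm] using this
  have hup := (convex_Icc 0 h).image_sub_le_mul_sub_of_deriv_le
    (f := fun τ : ℝ => ∫ y, F (y + τ • w) ∂ν) (C := r * ν.real univ)
    (fun τ _ => (hderiv τ).2.continuousAt.continuousWithinAt)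
    (fun τ _ => (hderiv τ).2.differentiableAt.differentiableWithinAt)
    (fun τ hτ => by rw [(hderiv τ).2.deriv]; exact hle τ (interior_subset hτ))
    0 ⟨le_rfl, hh⟩ h ⟨hh, le_rfl⟩ hh
  have hlow : a * ν.real univ ≤ (∫ y, F (y + h • w) ∂ν) - ∫ y, F (y + (0 : ℝ) • w) ∂ν := by
    rw [← integral_sub (hint h) (hint 0)]
    have : ∫ _, a ∂ν ≤ ∫ y, (F (y + h • w) - F (y + (0 : ℝ) • w)) ∂ν := by
      refine integral_mono_ae (integrable_const _) ((hint h).sub (hint 0)) ?_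
      rw [hν]
      filter_upwards [ae_restrict_mem measurableSet_ball] with y hy
      have := hsa (ball_subset_ball (min_le_left _ _) hy)
      simpa using (mem_Ioi.1 this).le
    simpa [integral_const, mul_comm] using this
  have hpos : 0 < ν.real univ := by
    rw [hν, measureReal_restrict_apply_univ]
    exact ENNReal.toReal_pos (measure_ball_pos μ z₀ hs'0).ne' measure_ball_lt_top.ne
  nlinarith

/-- Chain rule inequality for locally Lipschitz functions: a bound that holds almost everywhere for
the derivative along a continuous vector field holds for the upper right Dini derivative along every
curve that is tangent to the field. -/
theorem LocallyLipschitz.eventually_slope_lt (μ : Measure E) [μ.IsAddHaarMeasure] {F b : E → ℝ}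
    {G : E → E} (hF : LocallyLipschitz F)
    (hae : ∀ᵐ z ∂μ, DifferentiableAt ℝ F z → fderiv ℝ F z (G z) ≤ b z) {c : ℝ → E} {τ : ℝ}
    (hG : ContinuousAt G (c τ)) (hb : ContinuousAt b (c τ))
    (hc : HasDerivWithinAt c (G (c τ)) (Ici τ) τ) {r : ℝ} (hr : b (c τ) < r) :
    ∀ᶠ σ in 𝓝[>] τ, (σ - τ)⁻¹ * (F (c σ) - F (c τ)) < r := by
  obtain ⟨r', hbr', hr'r⟩ := exists_between hr
  set z₀ := c τ with hz₀
  set w := G z₀ with hw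
  obtain ⟨K, t, ht, hK⟩ := hF z₀
  obtain ⟨Fe, hFe, heq⟩ := hK.extend_real
  -- Replacing the varying direction `G z` by the fixed `w` costs at most `K * ‖G z - w‖`, which is
  -- small near `z₀`.
  have hb' : ContinuousAt (fun z => b z + K * ‖G z - w‖) z₀ :=
    hb.add (((hG.sub continuousAt_const).norm).const_mul _)
  have hev : ∀ᶠ z in 𝓝 z₀, b z + K * ‖G z - w‖ < r' ∧ t ∈ 𝓝 z := by
    refine (hb'.eventually_lt continuousAt_const ?_).and (eventually_mem_nhds_iff.2 ht)
    simpa [hw] using hbr'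
  obtain ⟨ρ, hρ, hball⟩ := Metric.eventually_nhds_iff_ball.1 hev
  have haeF : ∀ᵐ z ∂μ, z ∈ Metric.ball z₀ ρ → fderiv ℝ Fe z w ≤ r' := by
    filter_upwards [hae, hFe.ae_differentiableAt (μ := μ)] with z hz hd hzρ
    obtain ⟨hlt, htz⟩ := hball z hzρ
    have hEq : F =ᶠ[𝓝 z] Fe := Filter.eventually_of_mem htz heq
    have h1 := hz (hEq.differentiableAt_iff.2 hd)
    rw [hEq.fderiv_eq] at h1
    have h2 : fderiv ℝ Fe z (w - G z) ≤ K * ‖G z - w‖ := by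
      rw [norm_sub_rev]
      refine (le_abs_self _).trans (((fderiv ℝ Fe z).le_opNorm _).trans ?_)
      exact mul_le_mul_of_nonneg_right (norm_fderiv_le_of_lipschitz ℝ hFe) (norm_nonneg _)
    have h3 : fderiv ℝ Fe z w = fderiv ℝ Fe z (G z) + fderiv ℝ Fe z (w - G z) := by
      rw [← map_add]; congr 1; abel
    linarith
  -- Relative deviation allowed between the curve and its tangent: multiplied by `K`, it stays below
  -- the slack `r - r'`.
  have hη : 0 < (r - r') / (K + 1) := div_pos (by linarith) (by positivity)
  have hlo := (hasDerivWithinAt_iff_isLittleO.1 hc).def hη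
  have hct : ∀ᶠ σ in 𝓝[>] τ, c σ ∈ t :=
    (hc.continuousWithinAt.mono Ioi_subset_Ici_self).preimage_mem_nhdsWithin ht
  have hsmall : ∀ᶠ σ in 𝓝[>] τ, (σ - τ) * ‖w‖ < ρ := by
    refine (ContinuousAt.eventually_lt (f := fun σ => (σ - τ) * ‖w‖) (by fun_prop)
      continuousAt_const (by simpa using hρ)).filter_mono nhdsWithin_le_nhds
  filter_upwards [hlo.filter_mono (nhdsWithin_mono _ Ioi_subset_Ici_self), hct, hsmall,
    self_mem_nhdsWithin] with σ h1 h2 h3 h4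
  have hpos : 0 < σ - τ := sub_pos.2 h4
  have h5 := hFe.sub_le_of_ae_fderiv_le μ haeF hpos.le h3
  have h6 : Fe (c σ) - Fe (z₀ + (σ - τ) • w) ≤ K * ((r - r') / (K + 1) * (σ - τ)) := by
    refine (le_abs_self _).trans ?_
    rw [← Real.dist_eq]
    refine (hFe.dist_le_mul _ _).trans (mul_le_mul_of_nonneg_left ?_ K.2)
    rw [dist_eq_norm, ← sub_sub]
    rwa [Real.norm_of_nonneg hpos.le] at h1
  have h7 : K * ((r - r') / (K + 1) * (σ - τ)) < (r - r') * (σ - τ) := by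
    have : (K : ℝ) * ((r - r') / (K + 1)) < r - r' := by
      rw [mul_div_assoc', div_lt_iff₀ (by positivity)]
      nlinarith
    nlinarith
  rw [heq h2, heq (mem_of_mem_nhds ht), inv_mul_lt_iff₀ hpos]
  linarith

end DirectionalDerivative

/-! ### Growth over one admissible transmission interval -/

/-- The power series of `artanh` has only odd powers with nonnegative coefficients, and every odd
power of `θ` is at most `θ`. -/
theorem Real.artanh_mul_le {θ y : ℝ} (hθ0 : 0 ≤ θ) (hθ1 : θ ≤ 1) (hy0 : 0 ≤ y) (hy1 : y < 1) :
    Real.artanh (θ * y) ≤ θ * Real.artanh y := by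
  have hθy : θ * y ≤ y := by nlinarith
  have hθy0 : 0 ≤ θ * y := by positivity
  have key : ∀ z, 0 ≤ z → z < 1 →
      Real.artanh z = 1 / 2 * (Real.log (1 + z) - Real.log (1 - z)) := fun z h0 h1 => by
    rw [Real.artanh_eq_half_log ⟨by linarith, h1.le⟩, Real.log_div (by linarith) (by linarith)]
  have h1 := Real.hasSum_log_sub_log_of_abs_lt_one (x := θ * y)
    (by rw [abs_of_nonneg hθy0]; linarith)
  have h2 := (Real.hasSum_log_sub_log_of_abs_lt_one (x := y)
    (by rwa [abs_of_nonneg hy0])).mul_left θ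
  have h3 := hasSum_le (fun k => ?_) h1 h2
  · rw [key _ hθy0 (by linarith), key _ hy0 hy1]
    linarith
  · rw [mul_pow, ← mul_assoc, ← mul_assoc]
    refine mul_le_mul_of_nonneg_right ?_ (by positivity)
    rw [mul_comm θ]
    exact mul_le_mul_of_nonneg_left (pow_le_of_le_one hθ0 hθ1 (by omega)) (by positivity)

theorem Real.artanh_one_sub_sq_div {lam : ℝ} (h0 : 0 < lam) :
    Real.artanh ((1 - lam ^ 2) / (1 + lam ^ 2)) = -Real.log lam := by
  have hp : 0 < 1 + lam ^ 2 := by positivity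
  have hb : (1 - lam ^ 2) / (1 + lam ^ 2) ∈ Icc (-1 : ℝ) 1 := by
    constructor
    · rw [le_div_iff₀ hp]; nlinarith
    · rw [div_le_iff₀ hp]; nlinarith
  rw [Real.artanh_eq_half_log hb]
  have : (1 + (1 - lam ^ 2) / (1 + lam ^ 2)) / (1 - (1 - lam ^ 2) / (1 + lam ^ 2)) =
      (lam ^ 2)⁻¹ := by
    field_simp
    ring
  rw [this, Real.log_inv, Real.log_pow]
  push_cast
  ring

theorem matiBound_denominator {L ζ lamBar : ℝ} (h0 : 0 < lamBar) :
    2 * (lamBar / (1 + lamBar)) * (ζ - L) + L * (1 + lamBar) =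
      (2 * lamBar * ζ + L * (1 + lamBar ^ 2)) / (1 + lamBar) := by
  field_simp
  ring

/-- During one admissible transmission interval, growth at rate `L` is compensated by `lamBar`. -/
theorem exp_mul_le_one_of_le_matiBound {L ζ lamBar T : ℝ} (hL : 0 ≤ L) (hζ : 0 < ζ)
    (hlam : 0 < lamBar) (hT0 : 0 < T) (hT : T ≤ matiBound L ζ lamBar) :
    Real.exp (L * T) * lamBar ≤ 1 := by
  have hden : 0 < (2 * lamBar * ζ + L * (1 + lamBar ^ 2)) / (1 + lamBar) := by positivity
  unfold matiBound at hT
  rw [matiBound_denominator hlam] at hT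
  set D := (2 * lamBar * ζ + L * (1 + lamBar ^ 2)) / (1 + lamBar) with hD
  set a := √|ζ ^ 2 - L ^ 2| with ha
  have ha0 : 0 ≤ a := Real.sqrt_nonneg _
  -- For `lamBar ≥ 1` the bound would be nonpositive, contradicting `0 < T`.
  have hlam1 : lamBar < 1 := by
    by_contra! hge
    have hq : a * (1 - lamBar) / D ≤ 0 :=
      div_nonpos_of_nonpos_of_nonneg (mul_nonpos_of_nonneg_of_nonpos ha0 (by linarith)) hden.le
    split_ifs at hT with h1 h2
    · have : Real.arctan (a * (1 - lamBar) / D) ≤ 0 := by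
        rw [← Real.arctan_zero]; exact Real.arctan_mono hq
      nlinarith [mul_nonpos_of_nonneg_of_nonpos (by positivity : 0 ≤ 1 / a) this]
    · have : (1 - lamBar) / (1 + lamBar) ≤ 0 :=
        div_nonpos_of_nonpos_of_nonneg (by linarith) (by linarith)
      nlinarith [mul_nonpos_of_nonneg_of_nonpos (by positivity : 0 ≤ 1 / L) this]
    · nlinarith [mul_nonpos_of_nonneg_of_nonpos (by positivity : 0 ≤ 1 / a)
        (Real.artanh_nonpos hq)]
  have hlog : 1 - lamBar ≤ -Real.log lamBar := by
    linarith [Real.log_le_sub_one_of_pos hlam]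
  suffices h : L * T ≤ -Real.log lamBar by
    calc Real.exp (L * T) * lamBar ≤ Real.exp (-Real.log lamBar) * lamBar := by gcongr
      _ = 1 := by rw [Real.exp_neg, Real.exp_log hlam, inv_mul_cancel₀ hlam.ne']
  have hLT : L * T ≤ L * _ := mul_le_mul_of_nonneg_left hT hL
  refine hLT.trans ?_
  split_ifs with h1 h2
  · have ha1 : 0 < a := Real.sqrt_pos.2 (abs_pos.2 (by nlinarith))
    have hq : 0 ≤ a * (1 - lamBar) / D := by
      have : 0 ≤ 1 - lamBar := by linarith
      positivity
    have hat : Real.arctan (a * (1 - lamBar) / D) ≤ a * (1 - lamBar) / D := by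
      simpa [Real.tan_arctan] using
        Real.le_tan (Real.arctan_nonneg.2 hq) (Real.arctan_lt_pi_div_two _)
    have hLD : L * (1 - lamBar) / D ≤ 1 - lamBar := by
      rw [div_le_iff₀ hden, mul_comm]
      refine mul_le_mul_of_nonneg_left ?_ (by linarith)
      rw [hD, le_div_iff₀ (by linarith)]
      nlinarith [mul_pos hlam hζ, mul_nonneg hL (sq_nonneg lamBar),
        mul_nonneg hlam.le (sub_nonneg.2 h1.le)]
    calc L * (1 / a * Real.arctan (a * (1 - lamBar) / D))
        ≤ L * (1 / a * (a * (1 - lamBar) / D)) := by gcongr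
      _ = L * (1 - lamBar) / D := by field_simp
      _ ≤ _ := by linarith
  · have hL0 : 0 < L := h2 ▸ hζ
    rw [← mul_assoc, mul_one_div_cancel hL0.ne', one_mul]
    refine le_trans ?_ hlog
    rw [div_le_iff₀ (by linarith)]
    nlinarith
  · have hlt : ζ < L := lt_of_le_of_ne (not_lt.1 h1) h2
    have hL0 : 0 < L := hζ.trans hlt
    have ha1 : 0 < a := Real.sqrt_pos.2 (abs_pos.2 (by nlinarith))
    have haL : a ≤ L := by
      rw [ha, Real.sqrt_le_left hL, abs_of_neg (by nlinarith)]
      nlinarith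
    -- Dropping the `ζ` term of the denominator enlarges the argument to `a / L * Y`, and `artanh Y`
    -- is exactly `-log lamBar`.
    set Y := (1 - lamBar ^ 2) / (1 + lamBar ^ 2) with hY
    have hY0 : 0 ≤ Y := div_nonneg (by nlinarith) (by positivity)
    have hY1 : Y < 1 := by
      rw [hY, div_lt_one (by positivity)]; nlinarith
    have hyY : a * (1 - lamBar) / D ≤ a / L * Y := by
      rw [hY, div_mul_div_comm, div_le_div_iff₀ hden (by positivity), hD]
      rw [mul_div_assoc', le_div_iff₀ (by linarith)]
      have e : a * (1 - lamBar ^ 2) * (2 * lamBar * ζ + L * (1 + lamBar ^ 2)) -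
          a * (1 - lamBar) * (L * (1 + lamBar ^ 2)) * (1 + lamBar) =
          a * (1 - lamBar ^ 2) * (2 * lamBar * ζ) := by ring
      have : 0 ≤ a * (1 - lamBar ^ 2) * (2 * lamBar * ζ) :=
        mul_nonneg (mul_nonneg ha0 (by nlinarith)) (by positivity)
      linarith
    have hθ1 : a / L ≤ 1 := (div_le_one hL0).2 haL
    have hmono : Real.artanh (a * (1 - lamBar) / D) ≤ Real.artanh (a / L * Y) := by
      refine Real.artanh_le_artanh ?_ ?_ hyY
      · have : 0 ≤ a * (1 - lamBar) / D :=
          div_nonneg (mul_nonneg ha0 (by linarith)) hden.le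
        linarith
      · nlinarith [div_nonneg ha0 hL]
    calc L * (1 / a * Real.artanh (a * (1 - lamBar) / D))
        ≤ L * (1 / a * (a / L * Real.artanh Y)) := by
          gcongr
          exact hmono.trans (Real.artanh_mul_le (by positivity) hθ1 hY0 hY1)
      _ = Real.artanh Y := by field_simp
      _ = _ := Real.artanh_one_sub_sq_div hlam

/-! ### Hybrid time -/

/-- Values at transmission instants are those before the jump. Overwriting the left endpoint by the
right limit produces a genuine flow on a closed interval. -/
theorem continuousOn_update_Icc {X : Type*} [TopologicalSpace X] {f : ℝ → X} {a b : ℝ} {y : X}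
    (hab : a < b) (hf : ContinuousOn f (Ioo a b)) (hl : Tendsto f (𝓝[>] a) (𝓝 y))
    (hr : Tendsto f (𝓝[<] b) (𝓝 (f b))) : ContinuousOn (Function.update f a y) (Icc a b) := by
  intro τ hτ
  rcases eq_or_lt_of_le hτ.1 with rfl | h1
  · rw [continuousWithinAt_update_same, Icc_sdiff_left, nhdsWithin_Ioc_eq_nhdsGT hab]
    exact hl
  rw [continuousWithinAt_update_of_ne h1.ne']
  rcases eq_or_lt_of_le hτ.2 with rfl | h2
  · rw [← continuousWithinAt_sdiff_self, Icc_sdiff_right, ContinuousWithinAt,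
      nhdsWithin_Ico_eq_nhdsLT hab]
    exact hr
  · exact (hf.continuousAt (Ioo_mem_nhds h1 h2)).continuousWithinAt

theorem exists_mem_Ioc_of_tendsto_atTop {t : ℕ → ℝ} (htop : Tendsto t atTop atTop) {τ : ℝ} {K : ℕ}
    (hτ : t K < τ) : ∃ k, K ≤ k ∧ τ ∈ Ioc (t k) (t (k + 1)) := by
  have hex : ∃ j, τ ≤ t (K + j) := by
    obtain ⟨j, hj⟩ := (htop.eventually_ge_atTop τ).exists_forall_of_atTop
    exact ⟨j, hj _ (by omega)⟩
  classical
  have h0 : Nat.find hex ≠ 0 := fun h => by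
    have := Nat.find_spec hex
    rw [h] at this
    exact absurd hτ (not_lt.2 this)
  obtain ⟨j, hj⟩ := Nat.exists_eq_succ_of_ne_zero h0
  refine ⟨K + j, by omega, not_le.1 (Nat.find_min hex (m := j) (by omega)), ?_⟩
  have := Nat.find_spec hex
  rw [hj] at this
  exact this

/-! ### The minimum of `W` over the box -/

section BoxMin

variable {n : ℕ}

/-- The minimum of `W` over the augmented errors that are compatible with box size `s`. -/
noncomputable def boxMin (W : Vec n × ℝ → ℝ) (s : ℝ) : ℝ :=
  sInf ((fun u : Vec n => W (s • u, s)) '' Metric.closedBall 0 1)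

/-- Writing errors as `s • u` turns the moving box into the fixed compact unit ball, over which a
minimum depends continuously on the parameter. -/
theorem continuous_boxMin {W : Vec n × ℝ → ℝ} (hW : Continuous W) : Continuous (boxMin W) := by
  have hf : Continuous (Function.uncurry fun (s : ℝ) (u : Vec n) => W (s • u, s)) := by
    refine hW.comp ?_
    exact (continuous_fst.smul continuous_snd).prodMk continuous_fst
  exact (isCompact_closedBall (0 : Vec n) 1).continuous_sInf hf

theorem exists_boxMin_eq {W : Vec n × ℝ → ℝ} (hW : Continuous W) {s : ℝ} (hs : 0 ≤ s) :
    ∃ e : Vec n, ‖e‖ ≤ s ∧ boxMin W s = W (e, s) := by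
  obtain ⟨u, hu, h⟩ := (isCompact_closedBall (0 : Vec n) 1).exists_sInf_image_eq
    ⟨0, by simp⟩ (f := fun u : Vec n => W (s • u, s)) (by fun_prop)
  refine ⟨s • u, ?_, h⟩
  rw [norm_smul, Real.norm_of_nonneg hs]
  exact mul_le_of_le_one_right hs (by simpa using hu)

theorem boxMin_le {W : Vec n × ℝ → ℝ} (hW : Continuous W) {s : ℝ} {e : Vec n} (he : ‖e‖ ≤ s) :
    boxMin W s ≤ W (e, s) := by
  have hs : 0 ≤ s := (norm_nonneg e).trans he
  refine csInf_le ((isCompact_closedBall (0 : Vec n) 1).bddBelow_image (by fun_prop)) ?_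
  rcases eq_or_lt_of_le hs with rfl | hpos
  · exact ⟨0, by simp, by simp [norm_le_zero_iff.1 he]⟩
  · refine ⟨s⁻¹ • e, ?_, by simp [smul_smul, mul_inv_cancel₀ hpos.ne']⟩
    rw [mem_closedBall_zero_iff, norm_smul, norm_inv, Real.norm_of_nonneg hs, inv_mul_le_iff₀ hpos]
    simpa using he

end BoxMin

/-! ### Consequences of the Lyapunov conditions -/

namespace NCS

variable {n m M : ℕ} {N : NCS n m} {rate : Fin M → ℕ} {W : ℕ → Vec n × ℝ → ℝ}
  {V H : Vec n → ℝ} {lam : Fin M → ℝ} {L ζ αW βW αV βV ϱ : ℝ}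

theorem continuous_fTilde (N : NCS n m) : Continuous fun z : Vec n × Vec n => N.fTilde z.1 z.2 :=
  N.continuous_f.comp
    (continuous_fst.prodMk (N.continuous_κ.comp (continuous_fst.sub continuous_snd)))

theorem continuous_gE (N : NCS n m) : Continuous fun z : Vec n × Vec n => N.gE z.1 z.2 :=
  N.continuous_fTilde.sub (N.continuous_f.comp
    ((continuous_fst.sub continuous_snd).prodMk
      (N.continuous_κ.comp (continuous_fst.sub continuous_snd))))

theorem continuous_gBar (N : NCS n m) (x : Vec n) : Continuous (N.gBar x) :=
  (N.continuous_gE.comp (continuous_const.prodMk continuous_fst)).prodMk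
    (N.continuous_gξ.comp continuous_snd)

/-- Local solvability of the continuous dynamics of plant state and estimation error. -/
theorem exists_flow (N : NCS n m) (x₀ e₀ : Vec n) (τ : ℝ) :
    ∃ δ > 0, ∃ x e : ℝ → Vec n, x τ = x₀ ∧ e τ = e₀ ∧ ∀ σ ∈ Icc τ (τ + δ),
      HasDerivAt x (N.fTilde (x σ) (e σ)) σ ∧ HasDerivAt e (N.gE (x σ) (e σ)) σ := by
  obtain ⟨δ, hδ, c, hc0, hc⟩ := exists_hasDerivAt_of_continuous
    (v := fun z : Vec n × Vec n => (N.fTilde z.1 z.2, N.gE z.1 z.2))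
    (N.continuous_fTilde.prodMk N.continuous_gE) (x₀, e₀)
  refine ⟨δ, hδ, fun σ => (c (σ - τ)).1, fun σ => (c (σ - τ)).2, by simp [hc0], by simp [hc0],
    fun σ hσ => ?_⟩
  have h := (hc (σ - τ) ⟨by linarith [hσ.1], by linarith [hσ.2]⟩).comp_sub_const σ τ
  exact ⟨h.fst, h.snd⟩

namespace QuadraticConditions

theorem W_nonneg (hq : N.QuadraticConditions rate W V H lam L ζ αW βW αV βV ϱ) (k : ℕ)
    (eb : Vec n × ℝ) : 0 ≤ W k eb :=
  (mul_nonneg hq.αW_pos.le (norm_nonneg _)).trans (hq.W_bounds k eb).1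

theorem W_zero (hq : N.QuadraticConditions rate W V H lam L ζ αW βW αV βV ϱ) (k : ℕ) :
    W k 0 = 0 :=
  le_antisymm (by simpa using (hq.W_bounds k 0).2) (hq.W_nonneg k 0)

/-- At zero state and zero augmented error the condition on `V` leaves only `-H 0 ^ 2`. A nonzero
value would let `V` decrease from its minimum `V 0 = 0`. -/
theorem H_zero (hq : N.QuadraticConditions rate W V H lam L ζ αW βW αV βV ϱ) : H 0 = 0 := by
  by_contra hH
  -- A straight line suffices: the slope estimate needs tangency at one instant, not a solution.
  have hc : HasDerivWithinAt (fun σ : ℝ => σ • N.fTilde 0 0) (N.fTilde 0 0) (Ici 0) 0 := by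
    simpa using ((hasDerivAt_id (0 : ℝ)).smul_const (N.fTilde 0 0)).hasDerivWithinAt
  have hHc := hq.H_continuous
  have hev := hq.V_lipschitz.eventually_slope_lt volume (hq.V_flow 0 0) (τ := 0)
    (c := fun σ : ℝ => σ • N.fTilde 0 0) (r := 0)
    (N.continuous_fTilde.comp (continuous_id.prodMk continuous_const)).continuousAt
    (by fun_prop) (by simpa using hc) (by
      have : 0 < H 0 ^ 2 := by positivity
      simpa [hq.W_zero] using this)
  obtain ⟨σ, h1, h2⟩ := (hev.and self_mem_nhdsWithin).exists
  have hσ : 0 < σ := h2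
  have hV0 : V 0 ≤ 0 := by simpa using (hq.V_bounds 0).2
  have hV1 : 0 ≤ V (σ • N.fTilde 0 0) :=
    (mul_nonneg hq.αV_pos.le (sq_nonneg _)).trans (hq.V_bounds _).1
  simp only [zero_smul, sub_zero] at h1
  have := mul_nonneg (inv_nonneg.2 hσ.le) (sub_nonneg.2 (hV0.trans hV1))
  linarith

theorem le_boxMin (hq : N.QuadraticConditions rate W V H lam L ζ αW βW αV βV ϱ) (k : ℕ)
    {s : ℝ} (hs : 0 ≤ s) : αW * s ≤ boxMin (W k) s := by
  obtain ⟨e, he, h⟩ := exists_boxMin_eq (hq.W_lipschitz k).continuous hs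
  rw [h]
  refine (mul_le_mul_of_nonneg_left ?_ hq.αW_pos.le).trans (hq.W_bounds k _).1
  exact (le_abs_self s).trans (norm_snd_le (e, s))

/-- A minimising error is sent by the jump into the new box, so its image is an admissible
competitor there. -/
theorem boxMin_jump (hq : N.QuadraticConditions rate W V H lam L ζ αW βW αV βV ϱ) (k : ℕ)
    {s : ℝ} (hs : 0 ≤ s) (i : Fin M) :
    boxMin (W (k + 1)) (jumpXi s (rate i)) ≤ lam i * boxMin (W k) s := by
  obtain ⟨e, he, h⟩ := exists_boxMin_eq (hq.W_lipschitz k).continuous hs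
  rw [h]
  refine le_trans ?_ (hq.W_jump k 0 (e, s) i he)
  refine boxMin_le (hq.W_lipschitz (k + 1)).continuous ?_
  exact N.quantizer.mem_subbox _ _ _ _ _ (by simpa using he)

/-- Between transmissions the box size evolves on its own. Comparing it with a flow that starts from
plant state zero, where `H` vanishes, shows that `boxMin` grows at rate at most `L`. -/
theorem eventually_slope_boxMin_lt (hbox : N.BoxCapturesState)
    (hq : N.QuadraticConditions rate W V H lam L ζ αW βW αV βV ϱ) (k : ℕ) {a b τ : ℝ}
    {ξ : ℝ → ℝ} (hξ : ∀ σ ∈ Ioo a b, HasDerivAt ξ (N.gξ (ξ σ)) σ) (hτ : τ ∈ Ioo a b)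
    (hpos : 0 ≤ ξ τ) {r : ℝ} (hr : L * boxMin (W k) (ξ τ) < r) :
    ∀ᶠ σ in 𝓝[>] τ, (σ - τ)⁻¹ * (boxMin (W k) (ξ σ) - boxMin (W k) (ξ τ)) < r := by
  have hWc := (hq.W_lipschitz k).continuous
  have hvol : (volume : Measure (Vec n × ℝ)).IsAddHaarMeasure := by
    rw [Measure.volume_eq_prod]
    infer_instance
  -- Starting the error at a minimiser gives equality at `τ`. Box capture keeps it a competitor
  -- later, so `boxMin` stays below `W` along this flow.
  obtain ⟨e₀, he₀, hmin⟩ := exists_boxMin_eq hWc hpos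
  obtain ⟨δ, hδ, x, e, hx, he, hflow⟩ := N.exists_flow 0 e₀ τ
  obtain ⟨d, hd0, hd⟩ := exists_between (lt_min (show τ < τ + δ by linarith) hτ.2)
  have hdδ : d < τ + δ := hd.trans_le (min_le_left _ _)
  have hdb : d < b := hd.trans_le (min_le_right _ _)
  have hmem : ∀ σ ∈ Icc τ d, σ ∈ Icc τ (τ + δ) ∧ σ ∈ Ioo a b := fun σ hσ =>
    ⟨⟨hσ.1, hσ.2.trans hdδ.le⟩, hτ.1.trans_le hσ.1, hσ.2.trans_lt hdb⟩
  have hcap := hbox τ d x e ξ hd0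
    (fun σ hσ => (hflow σ (hmem σ hσ).1).1.continuousAt.continuousWithinAt)
    (fun σ hσ => (hflow σ (hmem σ hσ).1).2.continuousAt.continuousWithinAt)
    (fun σ hσ => (hξ σ (hmem σ hσ).2).continuousAt.continuousWithinAt)
    (fun σ hσ => ⟨(hflow σ (hmem σ (Ioo_subset_Icc_self hσ)).1).1,
      (hflow σ (hmem σ (Ioo_subset_Icc_self hσ)).1).2,
      hξ σ (hmem σ (Ioo_subset_Icc_self hσ)).2⟩) (by rwa [he])
  have hder : HasDerivAt (fun σ => (e σ, ξ σ)) (N.gBar 0 (e τ, ξ τ)) τ := by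
    have := (hflow τ (hmem τ ⟨le_rfl, hd0.le⟩).1).2.prodMk (hξ τ hτ)
    rwa [hx] at this
  have hev := (hq.W_lipschitz k).eventually_slope_lt volume (hq.W_flow k 0) (τ := τ)
    (c := fun σ => (e σ, ξ σ)) (r := r) (N.continuous_gBar 0).continuousAt
    (by fun_prop) hder.hasDerivWithinAt (by simpa [hq.H_zero, he, ← hmin] using hr)
  filter_upwards [hev, Ioo_mem_nhdsGT hd0] with σ h1 h2
  refine lt_of_le_of_lt ?_ h1
  refine mul_le_mul_of_nonneg_left ?_ (inv_nonneg.2 (sub_pos.2 h2.1).le)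
  have h3 := boxMin_le hWc (hcap σ (Ioo_subset_Icc_self h2))
  rw [he, ← hmin]
  linarith

end QuadraticConditions

/-! ### Convergence along a single trajectory -/

namespace IsTrajectory

variable {t : ℕ → ℝ} {x e : ℝ → Vec n} {ξ : ℝ → ℝ}

theorem norm_e_le_of_mem_Ioc {r : ℕ → ℕ} (htr : N.IsTrajectory t r x e ξ)
    (hbox : N.BoxCapturesState) (ht : StrictMono t) {k : ℕ} (hk : ‖e (t k)‖ ≤ ξ (t k)) {τ : ℝ}
    (hτ : τ ∈ Ioc (t k) (t (k + 1))) : ‖e τ‖ ≤ ξ τ := by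
  have hlt : t k < t (k + 1) := ht (Nat.lt_succ_self k)
  have hfl := htr.flow k
  have h := hbox (t k) (t (k + 1)) x
    (Function.update e (t k) (N.jumpE k (x (t k)) (e (t k)) (ξ (t k)) (r k)))
    (Function.update ξ (t k) (jumpXi (ξ (t k)) (r k))) hlt
    (htr.continuousOn_x.mono fun σ hσ => (ht.monotone (Nat.zero_le k)).trans hσ.1)
    (continuousOn_update_Icc hlt
      (fun σ hσ => (hfl σ hσ).2.1.continuousAt.continuousWithinAt) (htr.jump_e k) (htr.left_e k))
    (continuousOn_update_Icc hlt
      (fun σ hσ => (hfl σ hσ).2.2.continuousAt.continuousWithinAt) (htr.jump_ξ k) (htr.left_ξ k))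
    (fun σ hσ => by
      have hne : ∀ᶠ σ' in 𝓝 σ, σ' ≠ t k := eventually_ne_nhds hσ.1.ne'
      rw [Function.update_of_ne hσ.1.ne', Function.update_of_ne hσ.1.ne']
      refine ⟨(hfl σ hσ).1, (hfl σ hσ).2.1.congr_of_eventuallyEq ?_,
        (hfl σ hσ).2.2.congr_of_eventuallyEq ?_⟩
      · filter_upwards [hne] with σ' h' using Function.update_of_ne h' _ _
      · filter_upwards [hne] with σ' h' using Function.update_of_ne h' _ _)
    (by
      rw [Function.update_self, Function.update_self]
      exact N.quantizer.mem_subbox _ _ _ _ _ (by simpa using hk))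
    τ (Ioc_subset_Icc_self hτ)
  rwa [Function.update_of_ne hτ.1.ne', Function.update_of_ne hτ.1.ne'] at h

/-- The plant state never leaves the box. -/
theorem norm_e_le {r : ℕ → ℕ} (htr : N.IsTrajectory t r x e ξ) (hbox : N.BoxCapturesState)
    (ht : StrictMono t) (htop : Tendsto t atTop atTop) {τ : ℝ} (hτ : t 0 ≤ τ) : ‖e τ‖ ≤ ξ τ := by
  have hk : ∀ k, ‖e (t k)‖ ≤ ξ (t k) := fun k => by
    induction k with
    | zero => exact htr.initial
    | succ k ih =>
      exact htr.norm_e_le_of_mem_Ioc hbox ht ih ⟨ht (Nat.lt_succ_self k), le_rfl⟩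
  rcases eq_or_lt_of_le hτ with rfl | h
  · exact hk 0
  · obtain ⟨k, -, hmem⟩ := exists_mem_Ioc_of_tendsto_atTop htop h
    exact htr.norm_e_le_of_mem_Ioc hbox ht (hk k) hmem

variable {R : ℕ → Fin M}

/-- Grönwall's inequality from an instant `a` after the jump, followed by `a ↓ t k`, where `ξ` tends
to its value after the jump. The index of `W` moves to `k + 1` at that jump. -/
theorem boxMin_le_exp_mul (htr : N.IsTrajectory t (fun k => rate (R k)) x e ξ)
    (hbox : N.BoxCapturesState) (ht : StrictMono t) (htop : Tendsto t atTop atTop)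
    (hq : N.QuadraticConditions rate W V H lam L ζ αW βW αV βV ϱ) {k : ℕ} {τ : ℝ}
    (hτ : τ ∈ Ioc (t k) (t (k + 1))) :
    boxMin (W (k + 1)) (ξ τ) ≤
      Real.exp (L * (τ - t k)) * (lam (R k) * boxMin (W k) (ξ (t k))) := by
  have ht0 : t 0 ≤ t k := ht.monotone (Nat.zero_le k)
  have hξ0 : ∀ σ, t 0 ≤ σ → 0 ≤ ξ σ := fun σ hσ =>
    (norm_nonneg _).trans (htr.norm_e_le hbox ht htop hσ)
  have hξd : ∀ σ ∈ Ioo (t k) (t (k + 1)), HasDerivAt ξ (N.gξ (ξ σ)) σ := fun σ hσ =>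
    (htr.flow k σ hσ).2.2
  have hmc := continuous_boxMin (hq.W_lipschitz (k + 1)).continuous
  have hξc : ContinuousOn ξ (Ioc (t k) (t (k + 1))) := by
    have := continuousOn_update_Icc (ht (Nat.lt_succ_self k))
      (fun σ hσ => (hξd σ hσ).continuousAt.continuousWithinAt) (htr.jump_ξ k) (htr.left_ξ k)
    refine (this.mono Ioc_subset_Icc_self).congr fun σ hσ => ?_
    exact (Function.update_of_ne hσ.1.ne' _ _).symm
  have hstep : ∀ a ∈ Ioo (t k) τ,
      boxMin (W (k + 1)) (ξ τ) ≤ boxMin (W (k + 1)) (ξ a) * Real.exp (L * (τ - a)) := by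
    intro a ha
    rw [← gronwallBound_ε0]
    refine le_gronwallBound_of_liminf_deriv_right_le
      (f := fun σ => boxMin (W (k + 1)) (ξ σ)) (f' := fun σ => L * boxMin (W (k + 1)) (ξ σ))
      (b := τ) (hmc.comp_continuousOn (hξc.mono fun σ hσ => ⟨ha.1.trans_le hσ.1, hσ.2.trans hτ.2⟩))
      (fun σ hσ r hr => ?_) le_rfl (fun σ _ => by simp) τ ⟨ha.2.le, le_rfl⟩
    refine (hq.eventually_slope_boxMin_lt hbox (k + 1) hξd
      ⟨ha.1.trans_le hσ.1, hσ.2.trans_le hτ.2⟩ (hξ0 σ ?_) hr).frequently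
    exact ht0.trans (ha.1.le.trans hσ.1)
  have hlim : Tendsto (fun a => boxMin (W (k + 1)) (ξ a) * Real.exp (L * (τ - a))) (𝓝[>] t k)
      (𝓝 (boxMin (W (k + 1)) (jumpXi (ξ (t k)) (rate (R k))) * Real.exp (L * (τ - t k)))) := by
    refine ((hmc.tendsto _).comp (htr.jump_ξ k)).mul ?_
    have : Continuous fun a => Real.exp (L * (τ - a)) := by fun_prop
    exact (this.tendsto _).mono_left nhdsWithin_le_nhds
  refine (ge_of_tendsto hlim (by filter_upwards [Ioo_mem_nhdsGT hτ.1] using hstep)).trans ?_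
  rw [mul_comm]
  exact mul_le_mul_of_nonneg_left (hq.boxMin_jump k (hξ0 _ ht0) (R k)) (Real.exp_nonneg _)

/-- Squares match the `lam i ^ 2` in the rate condition and make the gains nonnegative whatever the
sign of `lam i`. -/
theorem boxMin_sq_le_prod (htr : N.IsTrajectory t (fun k => rate (R k)) x e ξ)
    (hbox : N.BoxCapturesState) (ht : StrictMono t) (htop : Tendsto t atTop atTop)
    (hq : N.QuadraticConditions rate W V H lam L ζ αW βW αV βV ϱ) {T : ℝ}
    (hT : ∀ k, t (k + 1) - t k ≤ T) (k : ℕ) :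
    ∀ τ ∈ Ioc (t k) (t (k + 1)), boxMin (W (k + 1)) (ξ τ) ^ 2 ≤
      boxMin (W 0) (ξ (t 0)) ^ 2 *
        ∏ l ∈ Finset.range (k + 1), (Real.exp (L * T) ^ 2 * lam (R l) ^ 2) := by
  have hξ0 : ∀ σ, t 0 ≤ σ → 0 ≤ ξ σ := fun σ hσ =>
    (norm_nonneg _).trans (htr.norm_e_le hbox ht htop hσ)
  have hm0 : ∀ (j : ℕ) (σ : ℝ), t 0 ≤ σ → 0 ≤ boxMin (W j) (ξ σ) := fun j σ hσ =>
    (mul_nonneg hq.αW_pos.le (hξ0 σ hσ)).trans (hq.le_boxMin j (hξ0 σ hσ))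
  have hone : ∀ j, ∀ τ ∈ Ioc (t j) (t (j + 1)), boxMin (W (j + 1)) (ξ τ) ^ 2 ≤
      boxMin (W j) (ξ (t j)) ^ 2 * (Real.exp (L * T) ^ 2 * lam (R j) ^ 2) := by
    intro j τ hτ
    have htj : t 0 ≤ t j := ht.monotone (Nat.zero_le j)
    have h1 := htr.boxMin_le_exp_mul hbox ht htop hq hτ
    have h2 := hm0 (j + 1) τ (htj.trans hτ.1.le)
    have h3 : Real.exp (L * (τ - t j)) ≤ Real.exp (L * T) := Real.exp_le_exp.2
      (mul_le_mul_of_nonneg_left (by linarith [hT j, hτ.2]) hq.L_nonneg)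
    calc boxMin (W (j + 1)) (ξ τ) ^ 2
        ≤ (Real.exp (L * (τ - t j)) * (lam (R j) * boxMin (W j) (ξ (t j)))) ^ 2 := by gcongr
      _ = Real.exp (L * (τ - t j)) ^ 2 * (lam (R j) * boxMin (W j) (ξ (t j))) ^ 2 := mul_pow _ _ _
      _ ≤ Real.exp (L * T) ^ 2 * (lam (R j) * boxMin (W j) (ξ (t j))) ^ 2 := by gcongr
      _ = _ := by ring
  have hnn : ∀ j, 0 ≤ Real.exp (L * T) ^ 2 * lam (R j) ^ 2 := fun j => by positivity
  have hk : ∀ j, boxMin (W j) (ξ (t j)) ^ 2 ≤ boxMin (W 0) (ξ (t 0)) ^ 2 *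
      ∏ l ∈ Finset.range j, (Real.exp (L * T) ^ 2 * lam (R l) ^ 2) := by
    intro j
    induction j with
    | zero => simp
    | succ j ih =>
      refine (hone j _ ⟨ht (Nat.lt_succ_self j), le_rfl⟩).trans ?_
      rw [Finset.prod_range_succ]
      exact (mul_le_mul_of_nonneg_right ih (hnn j)).trans_eq (mul_assoc _ _ _)
  intro τ hτ
  refine (hone k τ hτ).trans ?_
  rw [Finset.prod_range_succ]
  exact (mul_le_mul_of_nonneg_right (hk k) (hnn k)).trans_eq (mul_assoc _ _ _)

/-- The box shrinks to a point if the products of the jump gains beat the growth between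
transmissions. -/
theorem tendsto_ξ (htr : N.IsTrajectory t (fun k => rate (R k)) x e ξ)
    (hbox : N.BoxCapturesState) (ht : StrictMono t) (htop : Tendsto t atTop atTop)
    (hq : N.QuadraticConditions rate W V H lam L ζ αW βW αV βV ϱ) {T : ℝ}
    (hT : ∀ k, t (k + 1) - t k ≤ T)
    (hprod : Tendsto (fun k => ∏ l ∈ Finset.range k, (Real.exp (L * T) ^ 2 * lam (R l) ^ 2))
      atTop (𝓝 0)) : Tendsto ξ atTop (𝓝 0) := by
  have hξ0 : ∀ σ, t 0 ≤ σ → 0 ≤ ξ σ := fun σ hσ =>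
    (norm_nonneg _).trans (htr.norm_e_le hbox ht htop hσ)
  rw [Metric.tendsto_atTop]
  intro ε hε
  have hαε : 0 < (αW * ε) ^ 2 := by have := hq.αW_pos; positivity
  have hlim := hprod.const_mul (boxMin (W 0) (ξ (t 0)) ^ 2)
  rw [mul_zero] at hlim
  obtain ⟨K, hK⟩ := (hlim.eventually_lt_const hαε).exists_forall_of_atTop
  refine ⟨t K + 1, fun τ hτ => ?_⟩
  obtain ⟨k, hKk, hk⟩ := exists_mem_Ioc_of_tendsto_atTop htop (show t K < τ by linarith)
  have hτ0 : t 0 ≤ τ := (ht.monotone (Nat.zero_le k)).trans hk.1.le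
  have h1 := htr.boxMin_sq_le_prod hbox ht htop hq hT k τ hk
  have h2 := hK (k + 1) (by omega)
  have h3 := hq.le_boxMin (k + 1) (hξ0 τ hτ0)
  have h4 : (αW * ξ τ) ^ 2 < (αW * ε) ^ 2 :=
    (pow_le_pow_left₀ (mul_nonneg hq.αW_pos.le (hξ0 τ hτ0)) h3 2).trans_lt (h1.trans_lt h2)
  have h5 := lt_of_pow_lt_pow_left₀ 2 (by have := hq.αW_pos; positivity) h4
  rw [Real.dist_0_eq_abs, abs_of_nonneg (hξ0 τ hτ0)]
  exact lt_of_mul_lt_mul_left h5 hq.αW_pos.le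

/-- On a transmission interval with small box, `V` decays exponentially to a small value. -/
theorem V_sub_le (htr : N.IsTrajectory t (fun k => rate (R k)) x e ξ)
    (hbox : N.BoxCapturesState) (ht : StrictMono t) (htop : Tendsto t atTop atTop)
    (hq : N.QuadraticConditions rate W V H lam L ζ αW βW αV βV ϱ) {d : ℝ} {k : ℕ}
    (hd : ∀ τ, t k < τ → ζ ^ 2 * (βW * ξ τ) ^ 2 ≤ ϱ / βV * d) {τ : ℝ}
    (hτ : τ ∈ Icc (t k) (t (k + 1))) :
    V (x τ) - d ≤ (V (x (t k)) - d) * Real.exp (-(ϱ / βV) * (τ - t k)) := by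
  have hc0 : 0 < ϱ / βV := div_pos hq.ϱ_pos hq.βV_pos
  have ht0 : t 0 ≤ t k := ht.monotone (Nat.zero_le k)
  rcases eq_or_lt_of_le hτ.1 with rfl | hlt
  · simp
  have hVx : ContinuousOn (fun σ => V (x σ)) (Ici (t 0)) :=
    hq.V_lipschitz.continuous.comp_continuousOn htr.continuousOn_x
  have hstep : ∀ a ∈ Ioo (t k) τ,
      V (x τ) - d ≤ (V (x a) - d) * Real.exp (-(ϱ / βV) * (τ - a)) := by
    intro a ha
    -- The decay condition on `V` holds for every index of `W`, so `W 0` serves on all intervals.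
    have hg := le_gronwallBound_of_liminf_deriv_right_le
      (f := fun σ => V (x σ)) (K := -(ϱ / βV)) (ε := ϱ / βV * d) (a := a) (b := τ)
      (f' := fun σ => -ϱ * ‖x σ‖ ^ 2 - ϱ * W 0 (e σ, ξ σ) ^ 2 - H (x σ) ^ 2 +
        ζ ^ 2 * W 0 (e σ, ξ σ) ^ 2)
      (hVx.mono fun σ hσ => ht0.trans (ha.1.le.trans hσ.1)) (fun σ hσ r hr => ?_) le_rfl
      (fun σ hσ => ?_) τ ⟨ha.2.le, le_rfl⟩
    · rw [gronwallBound_of_K_ne_0 (neg_ne_zero.2 hc0.ne')] at hg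
      have : ϱ / βV * d / -(ϱ / βV) = -d := by
        rw [div_neg, mul_div_cancel_left₀ _ hc0.ne']
      rw [this] at hg
      linarith
    · have hσm : σ ∈ Ioo (t k) (t (k + 1)) := ⟨ha.1.trans_le hσ.1, hσ.2.trans_le hτ.2⟩
      have hHc := hq.H_continuous
      exact (hq.V_lipschitz.eventually_slope_lt volume (hq.V_flow 0 (e σ, ξ σ)) (c := x) (τ := σ)
        (N.continuous_fTilde.comp (continuous_id.prodMk continuous_const)).continuousAt
        (by fun_prop) (htr.flow k σ hσm).1.hasDerivWithinAt hr).frequently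
    · have hσk : t k < σ := ha.1.trans_le hσ.1
      have hbd := htr.norm_e_le hbox ht htop (ht0.trans hσk.le)
      have hW : W 0 (e σ, ξ σ) ≤ βW * ξ σ := by
        refine (hq.W_bounds 0 _).2.trans (mul_le_mul_of_nonneg_left ?_ hq.βW_pos.le)
        rw [Prod.norm_def]
        refine max_le hbd ?_
        rw [Real.norm_of_nonneg ((norm_nonneg _).trans hbd)]
      have hW2 : W 0 (e σ, ξ σ) ^ 2 ≤ (βW * ξ σ) ^ 2 :=
        pow_le_pow_left₀ (hq.W_nonneg 0 _) hW 2
      have h1 : ζ ^ 2 * W 0 (e σ, ξ σ) ^ 2 ≤ ϱ / βV * d :=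
        (mul_le_mul_of_nonneg_left hW2 (sq_nonneg ζ)).trans (hd σ hσk)
      have h2 : ϱ / βV * V (x σ) ≤ ϱ * ‖x σ‖ ^ 2 := by
        rw [div_mul_eq_mul_div, div_le_iff₀ hq.βV_pos]
        nlinarith [mul_le_mul_of_nonneg_left (hq.V_bounds (x σ)).2 hq.ϱ_pos.le]
      nlinarith [mul_nonneg hq.ϱ_pos.le (sq_nonneg (W 0 (e σ, ξ σ))), sq_nonneg (H (x σ))]
  have hlim : Tendsto (fun a => (V (x a) - d) * Real.exp (-(ϱ / βV) * (τ - a))) (𝓝[>] t k)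
      (𝓝 ((V (x (t k)) - d) * Real.exp (-(ϱ / βV) * (τ - t k)))) := by
    have hexp : Continuous fun a => Real.exp (-(ϱ / βV) * (τ - a)) := by fun_prop
    refine Tendsto.mul (Tendsto.sub_const ?_ d) ((hexp.tendsto _).mono_left nhdsWithin_le_nhds)
    exact (hVx (t k) ht0).mono_left (nhdsWithin_mono _ fun σ hσ => ht0.trans (le_of_lt hσ))
  exact ge_of_tendsto hlim (by filter_upwards [Ioo_mem_nhdsGT hlt] using hstep)

/-- `V (x ·)` is continuous across transmissions, so the interval estimates concatenate into one
exponential decay towards an arbitrarily small level `d`. -/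
theorem tendsto_x (htr : N.IsTrajectory t (fun k => rate (R k)) x e ξ)
    (hbox : N.BoxCapturesState) (ht : StrictMono t) (htop : Tendsto t atTop atTop)
    (hq : N.QuadraticConditions rate W V H lam L ζ αW βW αV βV ϱ)
    (hξ : Tendsto ξ atTop (𝓝 0)) : Tendsto x atTop (𝓝 0) := by
  have hc0 : 0 < ϱ / βV := div_pos hq.ϱ_pos hq.βV_pos
  rw [Metric.tendsto_atTop']
  intro ε hε
  -- Half of the target level: one half absorbs the forcing, the other the decaying transient.
  set d := αV * ε ^ 2 / 2 with hd
  have hd0 : 0 < d := by have := hq.αV_pos; positivity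
  have hlim : Tendsto (fun τ => ζ ^ 2 * (βW * ξ τ) ^ 2) atTop (𝓝 0) := by
    simpa using ((hξ.const_mul βW).pow 2).const_mul (ζ ^ 2)
  obtain ⟨τ₀, hτ₀⟩ := (hlim.eventually_le_const (mul_pos hc0 hd0)).exists_forall_of_atTop
  obtain ⟨K, hK⟩ := (htop.eventually_ge_atTop τ₀).exists
  have hchain : ∀ j, V (x (t (K + j))) - d ≤
      (V (x (t K)) - d) * Real.exp (-(ϱ / βV) * (t (K + j) - t K)) := by
    intro j
    induction j with
    | zero => simp
    | succ j ih =>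
      have h1 := htr.V_sub_le hbox ht htop hq (d := d) (k := K + j) (τ := t (K + j + 1))
        (fun τ hτ => hτ₀ τ (hK.trans ((ht.monotone (Nat.le_add_right K j)).trans hτ.le)))
        ⟨ht.monotone (Nat.le_succ _), le_rfl⟩
      refine h1.trans ((mul_le_mul_of_nonneg_right ih (Real.exp_nonneg _)).trans_eq ?_)
      rw [mul_assoc, ← Real.exp_add]
      congr 2
      rw [add_assoc]
      ring
  have hdecay : ∀ τ, t K < τ →
      V (x τ) - d ≤ (V (x (t K)) - d) * Real.exp (-(ϱ / βV) * (τ - t K)) := by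
    intro τ hτ
    obtain ⟨k, hKk, hk⟩ := exists_mem_Ioc_of_tendsto_atTop htop hτ
    obtain ⟨j, rfl⟩ := Nat.exists_eq_add_of_le hKk
    have h1 := htr.V_sub_le hbox ht htop hq (d := d) (k := K + j) (τ := τ)
        (fun τ hτ => hτ₀ τ (hK.trans ((ht.monotone (Nat.le_add_right K j)).trans hτ.le)))
        (Ioc_subset_Icc_self hk)
    refine h1.trans ((mul_le_mul_of_nonneg_right (hchain j) (Real.exp_nonneg _)).trans_eq ?_)
    rw [mul_assoc, ← Real.exp_add]
    congr 2
    ring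
  have hexp : Tendsto (fun τ => (V (x (t K)) - d) * Real.exp (-(ϱ / βV) * (τ - t K))) atTop
      (𝓝 0) := by
    have : Tendsto (fun τ => -(ϱ / βV) * (τ - t K)) atTop atBot :=
      (tendsto_atTop_add_const_right _ _ tendsto_id).const_mul_atTop_of_neg (neg_neg_of_pos hc0)
    simpa using (Real.tendsto_exp_atBot.comp this).const_mul (V (x (t K)) - d)
  obtain ⟨τ₁, hτ₁⟩ := (hexp.eventually_lt_const hd0).exists_forall_of_atTop
  refine ⟨max τ₁ (t K), fun τ hτ => ?_⟩
  have h1 := hdecay τ ((le_max_right _ _).trans_lt hτ)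
  have h2 := hτ₁ τ ((le_max_left _ _).trans hτ.le)
  have h3 := (hq.V_bounds (x τ)).1
  have h4 : αV * ‖x τ‖ ^ 2 < αV * ε ^ 2 := by linarith
  rw [dist_zero_right]
  exact lt_of_pow_lt_pow_left₀ 2 hε.le (lt_of_mul_lt_mul_left h4 hq.αV_pos.le)

end IsTrajectory

end NCS

/-! ### Random rates and products of gains -/

theorem row_sum_le_inftyNorm {M : ℕ} (B : Matrix (Fin M) (Fin M) ℝ) (i : Fin M) :
    ∑ j, B i j ≤ inftyNorm B := by
  have h : inftyNorm B = ((Finset.univ.sup fun i : Fin M => ∑ j, ‖B i j‖₊ : NNReal) : ℝ) :=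
    Matrix.linfty_opNorm_def B
  rw [h]
  calc ∑ j, B i j ≤ ∑ j, ‖B i j‖ := Finset.sum_le_sum fun j _ => Real.le_norm_self _
    _ = ((∑ j, ‖B i j‖₊ : NNReal) : ℝ) := by push_cast; rfl
    _ ≤ _ := NNReal.coe_le_coe.2
      (Finset.le_sup (f := fun i : Fin M => ∑ j, ‖B i j‖₊) (Finset.mem_univ i))

section Rates

variable {Ω S Pw : Type*} [MeasurableSpace Ω] {M : ℕ} [Fintype S] [Fintype Pw]
  {Pr : Measure Ω} {chan : S → Pw → Fin M → PMF (Fin M)} {μ : Fin M → PMF (S × Pw)}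
  {s : ℕ → Ω → S} {p : ℕ → Ω → Pw} {R : ℕ → Ω → Fin M}

theorem ofReal_rateMatrix (chan : S → Pw → Fin M → PMF (Fin M)) (μ : Fin M → PMF (S × Pw))
    (i j : Fin M) :
    ENNReal.ofReal (rateMatrix chan μ i j) = ∑ σ, ∑ π, chan σ π j i * μ j (σ, π) := by
  have hnn : ∀ σ π, 0 ≤ (chan σ π j i).toReal * (μ j (σ, π)).toReal := fun σ π => by positivity
  rw [rateMatrix, Matrix.of_apply,
    ENNReal.ofReal_sum_of_nonneg fun σ _ => Finset.sum_nonneg fun π _ => hnn σ π]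
  refine Finset.sum_congr rfl fun σ _ => ?_
  rw [ENNReal.ofReal_sum_of_nonneg fun π _ => hnn σ π]
  refine Finset.sum_congr rfl fun π _ => ?_
  rw [ENNReal.ofReal_mul ENNReal.toReal_nonneg, ENNReal.ofReal_toReal (PMF.apply_ne_top _ _),
    ENNReal.ofReal_toReal (PMF.apply_ne_top _ _)]

/-- From time `1` on, the rates evolve as a Markov chain with transition matrix `rateMatrix`. -/
theorem measure_rate_succ (hs : ∀ k, IsDiscreteRV (s k)) (hp : ∀ k, IsDiscreteRV (p k))
    (hchan : IsSDMC chan Pr s p R) (hμ : InducesJointLaw μ Pr s p R) {k : ℕ} (hk : 1 ≤ k)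
    (ρ : ℕ → Fin M) (i : Fin M) :
    Pr {ω | (∀ l ≤ k, R l ω = ρ l) ∧ R (k + 1) ω = i} =
      ENNReal.ofReal (rateMatrix chan μ i (ρ k)) * Pr {ω | ∀ l ≤ k, R l ω = ρ l} := by
  set A := {ω | (∀ l ≤ k, R l ω = ρ l) ∧ R (k + 1) ω = i} with hA
  have hpre : ∀ y : S × Pw, (fun ω => (s k ω, p k ω)) ⁻¹' {y} =
      s k ⁻¹' {y.1} ∩ p k ⁻¹' {y.2} := fun y => by
    ext ω; simp [Prod.ext_iff]
  -- Total probability over the finitely many values of environment state and power.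
  have h := sum_measure_preimage_singleton (μ := Pr.restrict A) Finset.univ
    (f := fun ω => (s k ω, p k ω)) fun y _ => by rw [hpre]; exact (hs k _).inter (hp k _)
  rw [Finset.coe_univ, preimage_univ, Measure.restrict_apply_univ] at h
  rw [← h, ofReal_rateMatrix, Fintype.sum_prod_type, Finset.sum_mul]
  refine Finset.sum_congr rfl fun σ _ => ?_
  rw [Finset.sum_mul]
  refine Finset.sum_congr rfl fun π _ => ?_
  rw [Measure.restrict_apply (by rw [hpre]; exact (hs k _).inter (hp k _)), mul_assoc,
    ← hμ k hk ρ σ π, ← hchan k ρ σ π i]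
  congr 1
  ext ω
  simp only [hA, mem_inter_iff, mem_preimage, mem_singleton_iff, Prod.mk.injEq, mem_ofPred_eq]
  tauto

/-- The product of gains `g` of the first `k + 1` rates. -/
noncomputable def gainProd (g : Fin M → ENNReal) (R : ℕ → Ω → Fin M) (k : ℕ) (ω : Ω) : ENNReal :=
  ∏ l ∈ Finset.range (k + 1), g (R l ω)

theorem measurable_rate (hR : ∀ k, IsDiscreteRV (R k)) (k : ℕ) : Measurable (R k) :=
  measurable_to_countable' (hR k)

theorem measurable_gainProd (hR : ∀ k, IsDiscreteRV (R k)) (g : Fin M → ENNReal) (k : ℕ) :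
    Measurable (gainProd g R k) :=
  Finset.measurable_fun_prod _ fun l _ =>
    (measurable_of_countable g).comp (measurable_rate hR l)

theorem lintegral_history (hR : ∀ k, IsDiscreteRV (R k)) (ν : Measure Ω) (k : ℕ)
    (G : (Fin (k + 1) → Fin M) → ENNReal) :
    ∫⁻ ω, G (fun l => R l ω) ∂ν = ∑ ρ, G ρ * ν {ω | ∀ l : Fin (k + 1), R l ω = ρ l} := by
  have hm : Measurable fun ω (l : Fin (k + 1)) => R l ω :=
    measurable_pi_lambda _ fun l => measurable_rate hR l
  rw [← lintegral_map (measurable_of_countable G) hm, lintegral_fintype]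
  refine Finset.sum_congr rfl fun ρ _ => ?_
  rw [Measure.map_apply hm (measurableSet_singleton ρ)]
  congr 2
  ext ω
  simp [funext_iff]

/-- Splitting expectations by the current rate makes the recursion linear. The new gain depends on
the row index `i`, so the matrix is the gain diagonal times `rateMatrix`, and row sums control it.
-/
theorem lintegral_gainProd_succ (hs : ∀ k, IsDiscreteRV (s k)) (hp : ∀ k, IsDiscreteRV (p k))
    (hR : ∀ k, IsDiscreteRV (R k)) (hchan : IsSDMC chan Pr s p R)
    (hμ : InducesJointLaw μ Pr s p R) (g : Fin M → ENNReal) {k : ℕ} (hk : 1 ≤ k) (i : Fin M) :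
    ∫⁻ ω in R (k + 1) ⁻¹' {i}, gainProd g R (k + 1) ω ∂Pr =
      ∑ j, g i * ENNReal.ofReal (rateMatrix chan μ i j) *
        ∫⁻ ω in R k ⁻¹' {j}, gainProd g R k ω ∂Pr := by
  set P : Fin M → ENNReal := fun j => ENNReal.ofReal (rateMatrix chan μ i j) with hP
  let G : (Fin (k + 1) → Fin M) → ENNReal := fun ρ => ∏ l, g (ρ l)
  have hG : ∀ ω, gainProd g R k ω = G fun l => R l ω := fun ω =>
    (Fin.prod_univ_eq_prod_range (fun l => g (R l ω)) (k + 1)).symm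
  have hGm := measurable_gainProd hR g k
  have h1 : ∫⁻ ω in R (k + 1) ⁻¹' {i}, gainProd g R (k + 1) ω ∂Pr =
      g i * ∫⁻ ω in R (k + 1) ⁻¹' {i}, gainProd g R k ω ∂Pr := by
    rw [← lintegral_const_mul _ hGm]
    refine setLIntegral_congr_fun (hR _ i) fun ω hω => ?_
    have : R (k + 1) ω = i := hω
    simp only [gainProd]
    rw [Finset.prod_range_succ _ (k + 1), this, mul_comm]
  have h2 : ∫⁻ ω in R (k + 1) ⁻¹' {i}, gainProd g R k ω ∂Pr =
      ∫⁻ ω, P (R k ω) * gainProd g R k ω ∂Pr := by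
    simp only [hG]
    rw [lintegral_history hR _ k G]
    refine Eq.trans ?_ (lintegral_history hR Pr k fun ρ => P (ρ (Fin.last k)) * G ρ).symm
    refine Finset.sum_congr rfl fun ρ _ => ?_
    -- The value beyond the horizon is arbitrary; only indices up to `k` are read.
    let ρ' : ℕ → Fin M := fun l => if h : l < k + 1 then ρ ⟨l, h⟩ else i
    have hρ' : ∀ ω, (∀ l : Fin (k + 1), R l ω = ρ l) ↔ ∀ l ≤ k, R l ω = ρ' l := fun ω => by
      constructor
      · intro h l hl
        simp only [ρ', dif_pos (Nat.lt_succ_of_le hl)]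
        exact h ⟨l, Nat.lt_succ_of_le hl⟩
      · intro h l
        have := h l (Nat.le_of_lt_succ l.2)
        simpa only [ρ', dif_pos l.2] using this
    have h3 := measure_rate_succ hs hp hchan hμ hk ρ' i
    have h4 : ρ' k = ρ (Fin.last k) := by simp [ρ', Fin.last]
    rw [h4] at h3
    simp only [hρ']
    rw [Measure.restrict_apply' (hR _ i), mul_comm (P _), mul_assoc]
    congr 1
  have h5 : ∫⁻ ω, P (R k ω) * gainProd g R k ω ∂Pr =
      ∑ j, P j * ∫⁻ ω in R k ⁻¹' {j}, gainProd g R k ω ∂Pr := by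
    have hind : ∀ ω, P (R k ω) * gainProd g R k ω =
        ∑ j, P j * (R k ⁻¹' {j}).indicator (gainProd g R k) ω := fun ω => by
      rw [Finset.sum_eq_single (R k ω)]
      · simp
      · intro j _ hj
        rw [indicator_of_notMem, mul_zero]
        exact fun h => hj h.symm
      · simp
    simp only [hind]
    rw [lintegral_finsetSum _ fun j _ => (hGm.indicator (hR k j)).const_mul _]
    refine Finset.sum_congr rfl fun j _ => ?_
    rw [lintegral_const_mul _ (hGm.indicator (hR k j)), lintegral_indicator (hR k j)]
  rw [h1, h2, h5, Finset.mul_sum]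
  exact Finset.sum_congr rfl fun j _ => (mul_assoc _ _ _).symm

/-- If the gain-weighted transition matrix has row sums below one, the products of gains vanish
almost surely. -/
theorem ae_tendsto_gainProd [IsFiniteMeasure Pr] (hs : ∀ k, IsDiscreteRV (s k))
    (hp : ∀ k, IsDiscreteRV (p k))
    (hR : ∀ k, IsDiscreteRV (R k)) (hchan : IsSDMC chan Pr s p R)
    (hμ : InducesJointLaw μ Pr s p R) {g : Fin M → ENNReal} (hg : ∀ i, g i ≠ ⊤) {θ : ENNReal}
    (hθ : θ < 1) (hrow : ∀ i, ∑ j, g i * ENNReal.ofReal (rateMatrix chan μ i j) ≤ θ) :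
    ∀ᵐ ω ∂Pr, Tendsto (fun k => gainProd g R (k + 1) ω) atTop (𝓝 0) := by
  -- The joint law is known only from time `1`, so the gains at times `0` and `1` are bounded
  -- crudely.
  set C : ENNReal := ∏ _l ∈ Finset.range 2, ∑ i, g i with hC
  have hbound : ∀ k i, ∫⁻ ω in R (k + 1) ⁻¹' {i}, gainProd g R (k + 1) ω ∂Pr ≤
      θ ^ k * (C * Pr univ) := by
    intro k
    induction k with
    | zero =>
      intro i
      rw [pow_zero, one_mul]
      refine (setLIntegral_le_lintegral _ _).trans ?_
      rw [← lintegral_const]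
      exact lintegral_mono fun ω => Finset.prod_le_prod' fun l _ =>
        Finset.single_le_sum (fun _ _ => zero_le) (Finset.mem_univ (R l ω))
    | succ k ih =>
      intro i
      rw [lintegral_gainProd_succ hs hp hR hchan hμ g (by omega) i]
      calc _ ≤ ∑ j, g i * ENNReal.ofReal (rateMatrix chan μ i j) * (θ ^ k * (C * Pr univ)) :=
            Finset.sum_le_sum fun j _ => mul_le_mul_right (ih j) _
        _ ≤ θ * (θ ^ k * (C * Pr univ)) := by
            rw [← Finset.sum_mul]
            exact mul_le_mul_left (hrow i) _
        _ = θ ^ (k + 1) * (C * Pr univ) := by rw [pow_succ', mul_assoc]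
  have htot : ∀ k, ∫⁻ ω, gainProd g R (k + 1) ω ∂Pr ≤ θ ^ k * (M * (C * Pr univ)) := by
    intro k
    have : ∫⁻ ω, gainProd g R (k + 1) ω ∂Pr =
        ∑ i, ∫⁻ ω in R (k + 1) ⁻¹' {i}, gainProd g R (k + 1) ω ∂Pr := by
      simp_rw [← lintegral_indicator (hR (k + 1) _)]
      rw [← lintegral_finsetSum _ fun i _ => (measurable_gainProd hR g (k + 1)).indicator (hR _ i)]
      refine lintegral_congr fun ω => ?_
      rw [Finset.sum_eq_single (R (k + 1) ω)]
      · simp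
      · intro j _ hj
        exact indicator_of_notMem (fun h => hj h.symm) _
      · simp
    rw [this]
    refine (Finset.sum_le_sum fun i _ => hbound k i).trans_eq ?_
    rw [Finset.sum_const, Finset.card_univ, Fintype.card_fin, nsmul_eq_mul]
    ring
  have hCtop : C ≠ ⊤ := ENNReal.prod_ne_top fun _ _ => ENNReal.sum_ne_top.2 fun i _ => hg i
  -- A nonnegative series with finite expected sum converges almost surely, so its terms vanish; no
  -- independence is needed.
  have hfin : ∫⁻ ω, ∑' k, gainProd g R (k + 1) ω ∂Pr ≠ ⊤ := by
    rw [lintegral_tsum fun k => (measurable_gainProd hR g (k + 1)).aemeasurable]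
    refine ne_top_of_le_ne_top ?_ (ENNReal.tsum_le_tsum htot)
    rw [ENNReal.tsum_mul_right, ENNReal.tsum_geometric]
    refine ENNReal.mul_ne_top (ENNReal.inv_ne_top.2 (tsub_pos_of_lt hθ).ne') ?_
    exact ENNReal.mul_ne_top (ENNReal.natCast_ne_top M)
      (ENNReal.mul_ne_top hCtop (measure_ne_top _ _))
  filter_upwards [ae_lt_top (Measurable.tsum fun k => measurable_gainProd hR g (k + 1)) hfin]
    with ω hω
  exact ENNReal.tendsto_atTop_zero_of_tsum_ne_top hω.ne

end Rates

/-! ### Almost sure asymptotic stability -/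

theorem isASAS_of_ae_tendsto {Ω : Type*} [MeasurableSpace Ω] {Pr : Measure Ω} {n : ℕ}
    {x : Ω → ℝ → Vec n} (h : ∀ᵐ ω ∂Pr, Tendsto (x ω) atTop (𝓝 0)) : IsASAS Pr x := by
  intro ε hε
  refine measure_mono_null ?_ (ae_iff.1 h)
  intro ω hω htend
  obtain ⟨t', ht'⟩ := (Metric.tendsto_atTop.1 htend) (ε / 2) (by positivity)
  have h1 : ⨅ t' : ℝ, ⨆ t ≥ t', ‖x ω t‖ₑ ≤ ENNReal.ofReal (ε / 2) := by
    refine (iInf_le _ t').trans (iSup₂_le fun t ht => ?_)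
    rw [← ofReal_norm]
    exact ENNReal.ofReal_le_ofReal (by simpa using (ht' t ht).le)
  have h2 := (ENNReal.ofReal_le_ofReal_iff (by positivity)).1 (le_trans hω h1)
  linarith

theorem mainTheorem2 {n m M : ℕ} {S A Pw Ω : Type*} [Fintype S] [Fintype A] [Fintype Pw]
    [MeasurableSpace Ω] (Pr : Measure Ω) [IsProbabilityMeasure Pr]
    -- the closed-loop system with its box-based quantizer
    (N : NCS n m) (hbox : N.BoxCapturesState)
    -- data rates, environment, channel, and the law induced by the joint policy
    (rate : Fin M → ℕ) (hrate : StrictMono rate)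
    (env : MDP S A) (chan : S → Pw → Fin M → PMF (Fin M)) (μ : Fin M → PMF (S × Pw))
    (s : ℕ → Ω → S) (a : ℕ → Ω → A) (p : ℕ → Ω → Pw) (R : ℕ → Ω → Fin M)
    (hs : ∀ k, IsDiscreteRV (s k)) (ha : ∀ k, IsDiscreteRV (a k))
    (hp : ∀ k, IsDiscreteRV (p k)) (hR : ∀ k, IsDiscreteRV (R k))
    (henv : env.Governs Pr s a) (hchan : IsSDMC chan Pr s p R)
    (hμ : InducesJointLaw μ Pr s p R)
    -- the Lyapunov-type conditions
    (W : ℕ → Vec n × ℝ → ℝ) (V H : Vec n → ℝ) (lam : Fin M → ℝ)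
    (L ζ αW βW αV βV ϱ : ℝ)
    (hquad : N.QuadraticConditions rate W V H lam L ζ αW βW αV βV ϱ)
    -- the condition on `lamBar` and the bound on the transmission intervals
    (lamBar TMATI : ℝ)
    (hlam : √(inftyNorm (Matrix.diagonal (fun i => lam i ^ 2) * rateMatrix chan μ)) < lamBar)
    (hMATI : TMATI ≤ matiBound L ζ lamBar)
    -- the transmission instants
    (t : ℕ → ℝ) (ht : StrictMono t) (htop : Tendsto t atTop atTop)
    (hT : ∀ k, t (k + 1) - t k ≤ TMATI)
    -- the resulting trajectories
    (x e : Ω → ℝ → Vec n) (ξ : Ω → ℝ → ℝ)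
    (hsol : ∀ᵐ ω ∂Pr, N.IsTrajectory t (fun k => rate (R k ω)) (x ω) (e ω) (ξ ω)) :
    IsASAS Pr x := by
  set B := Matrix.diagonal (fun i => lam i ^ 2) * rateMatrix chan μ with hB
  have hlam0 : 0 < lamBar := (Real.sqrt_nonneg _).trans_lt hlam
  have hBlam : inftyNorm B < lamBar ^ 2 := (Real.sqrt_lt' hlam0).1 hlam
  have hT0 : 0 < TMATI := (sub_pos.2 (ht (Nat.lt_succ_self 0))).trans_le (hT 0)
  have hexp := exp_mul_le_one_of_le_matiBound hquad.L_nonneg hquad.ζ_pos hlam0 hT0 hMATI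
  set q := Real.exp (L * TMATI) with hq
  have hq0 : 0 < q := Real.exp_pos _
  set g : Fin M → ENNReal := fun i => ENNReal.ofReal (q ^ 2 * lam i ^ 2) with hg
  -- The strict inequality comes from the choice of `lamBar`; the interval bound contributes only `q
  -- * lamBar ≤ 1`.
  have hθ : ENNReal.ofReal (q ^ 2 * inftyNorm B) < 1 := by
    rw [← ENNReal.ofReal_one, ENNReal.ofReal_lt_ofReal_iff one_pos]
    calc q ^ 2 * inftyNorm B < q ^ 2 * lamBar ^ 2 := by gcongr
      _ = (q * lamBar) ^ 2 := (mul_pow _ _ _).symm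
      _ ≤ 1 := pow_le_one₀ (by positivity) hexp
  have hP0 : ∀ i j, 0 ≤ rateMatrix chan μ i j := fun i j =>
    Finset.sum_nonneg fun σ _ => Finset.sum_nonneg fun π _ => by positivity
  have hrow : ∀ i, ∑ j, g i * ENNReal.ofReal (rateMatrix chan μ i j) ≤
      ENNReal.ofReal (q ^ 2 * inftyNorm B) := by
    intro i
    have h1 : ∑ j, g i * ENNReal.ofReal (rateMatrix chan μ i j) =
        ENNReal.ofReal (q ^ 2 * ∑ j, B i j) := by
      rw [Finset.mul_sum, ENNReal.ofReal_sum_of_nonneg fun j _ => ?_]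
      · refine Finset.sum_congr rfl fun j _ => ?_
        rw [hg, ← ENNReal.ofReal_mul (by positivity), hB, Matrix.diagonal_mul, mul_assoc]
      · rw [hB, Matrix.diagonal_mul]
        exact mul_nonneg (sq_nonneg q) (mul_nonneg (sq_nonneg _) (hP0 i j))
    rw [h1]
    exact ENNReal.ofReal_le_ofReal
      (mul_le_mul_of_nonneg_left (row_sum_le_inftyNorm B i) (sq_nonneg q))
  refine isASAS_of_ae_tendsto ?_
  filter_upwards [hsol, ae_tendsto_gainProd hs hp hR hchan hμ (g := g)
    (fun i => ENNReal.ofReal_ne_top) hθ hrow] with ω htr hprod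
  refine htr.tendsto_x hbox ht htop hquad (htr.tendsto_ξ hbox ht htop hquad hT ?_)
  -- `gainProd g R (k + 1)` has `k + 2` factors.
  rw [← tendsto_add_atTop_iff_nat 2]
  have h2 := (ENNReal.tendsto_toReal ENNReal.zero_ne_top).comp hprod
  refine h2.congr fun k => ?_
  simp only [Function.comp_apply, gainProd, hg]
  rw [ENNReal.toReal_prod]
  exact Finset.prod_congr rfl fun l _ => ENNReal.toReal_ofReal (by positivity)
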